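/- For $1<\alpha<2$ and $|\beta|<1$ let $f(x;\mu,\sigma,\alpha,\beta)$ be the density of the stable law with characteristic function $$\Phi(t)=\exp\Big(-|\sigma t|^{\alpha}\Big\{1+i\beta\,(\operatorname{sgn}t)\tan\big(\tfrac{\pi\alpha}{2}\big)\big(|\sigma t|^{1-\alpha}-1\big)\Big\}+i\mu t\Big),$$ that is, $f(x;\mu,\sigma,\alpha,\beta)=\frac1{2\pi}\int_{-\infty}^{\infty}e^{-itx}\Phi(t)\,dt$, and let $f_\sigma(x;\alpha,\beta)=\frac{\partial}{\partial\sigma}f(x;0,\sigma,\alpha,\beta)\big|_{\sigma=1}$. Put $$\Delta=2-\alpha,\qquad \zeta=-\beta\tan\big(\tfrac{\pi\alpha}{2}\big),\qquad y=x-\zeta,\qquad \beta^{*}=\beta\operatorname{sgn}y,$$ and let $\varphi(y)=\frac{1}{2\sqrt\pi}e^{-y^2/4}$ be the density of $N(0,2)$. Define $$g=\varphi(y)+(1+\beta^{*})\,\Delta\,|y|^{\Delta-3},\qquad g'=-\tfrac{y}{2}\varphi(y)-3(1+\beta^{*})\,\Delta\,(\operatorname{sgn}y)\,|y|^{\Delta-4}$$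 ($g'$ is a name; it is not exactly the derivative of $g$) and $$g_\sigma=-g-(x-\zeta)\,g',\qquad F_\sigma^1=\frac{(x-\zeta)^2}{2},\qquad F_\sigma^2=2 .$$ Fix $\beta\in(-1,1)$. Then the following hold. 1. For every $\epsilon>0$ there are $\Delta_0>0$ and $x_0>0$ such that for all $0<\Delta<\Delta_0$ and all real $x$ with $|x|>x_0$, $$\left|\frac{f_\sigma(x;\alpha,\beta)}{g_\sigma(x;\alpha,\beta)}-1\right|<\epsilon .$$ 2. Let $0<\delta<2$ and $x_0>0$. As $\Delta\downarrow0$, uniformly in $|x|>x_0$, $$\frac{g_\sigma}{g}=\begin{cases}F_\sigma^1-1+o(\Delta^{\delta/2})\,F_\sigma^1 & \text{if } |x-\zeta|\le(2-\delta)(\log 1/\Delta)^{1/2},\\[1mm] F_\sigma^2\,\big(1+o(\Delta^{\delta/2})\big) & \text{if } |x-\zeta|\ge(2+\delta)(\log 1/\Delta)^{1/2}.\end{cases}$$ 3. In particular $g_\sigma/g$ is asymptotic to $F_\sigma^1$ in the Gaussian zone: for every $0<\delta<2$ and $\epsilon>0$ there are $\Delta_0>0$ and $x_0>0$ such that $\left|\frac{g_\sigma/g}{F_\sigma^1}-1\right|<\epsilon$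 whenever $0<\Delta<\Delta_0$, $|x|>x_0$ and $|x-\zeta|\le(2-\delta)(\log1/\Delta)^{1/2}$. 4. There is a constant $c>0$ such that for every $0<\delta<2$ there is $\Delta_0>0$ such that, for all $0<\Delta<\Delta_0$ and all real $x$ for which $|x|$ or $|x-\zeta|$ lies in the interval $\big[(2-\delta)(\log 1/\Delta)^{1/2},\,(2+\delta)(\log 1/\Delta)^{1/2}\big]$, $$\left|\frac{g_\sigma}{g}\right|\le c\,x^2 .$$ -/

import Mathlib

open MeasureTheory

noncomputable section

namespace Stable

/-- The characteristic function of the stable law with location `μ`, scale `σ`, characteristic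
exponent `α ≠ 1` and skewness `β`, in Zolotarev's (M) parameterization. -/
def charFn (μ σ α β t : ℝ) : ℂ :=
  Complex.exp
    (-((|σ * t| ^ α : ℝ) : ℂ) *
        (1 + Complex.I *
          ((β * Real.sign t * Real.tan (Real.pi * α / 2) * (|σ * t| ^ (1 - α) - 1) : ℝ) : ℂ))
      + Complex.I * ((μ * t : ℝ) : ℂ))

/-- The density `f(x; μ, σ, α, β)` of the stable law with characteristic function `charFn μ σ α β`:
the inverse Fourier transform of the (integrable) characteristic function. -/
def density (μ σ α β x : ℝ) : ℝ :=
  (1 / (2 * Real.pi)) *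
    (∫ t : ℝ, Complex.exp (-(Complex.I * ((t * x : ℝ) : ℂ))) * charFn μ σ α β t).re

/-- The derivative `f_σ(x; α, β)` of the density with respect to the scale, at `(μ, σ) = (0, 1)`. -/
def densityScale (α β x : ℝ) : ℝ :=
  deriv (fun σ : ℝ => density 0 σ α β x) 1

/-- The shift `ζ = -β tan (π α / 2)`. -/
def zeta (α β : ℝ) : ℝ := -β * Real.tan (Real.pi * α / 2)

/-- `β* = β sgn (x - ζ)`. -/
def betaStar (α β x : ℝ) : ℝ := β * Real.sign (x - zeta α β)

/-- The Gaussian part `F₁ = f(x - ζ; 2)`, with `f(·; 2)` the density of `N(0, 2)`. -/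
def F₁ (α β x : ℝ) : ℝ := ProbabilityTheory.gaussianPDFReal 0 2 (x - zeta α β)

/-- The tail part `F₂ = (1 + β*) Δ |x - ζ| ^ (Δ - 3)`, where `Δ = 2 - α`. -/
def F₂ (α β x : ℝ) : ℝ :=
  (1 + betaStar α β x) * (2 - α) * |x - zeta α β| ^ ((2 - α) - 3)

/-- The approximation `g = F₁ + F₂` of the density. -/
def g (α β x : ℝ) : ℝ := F₁ α β x + F₂ α β x

/-- `F₁' = -((x - ζ) / 2) f(x - ζ; 2)`. -/
def F₁' (α β x : ℝ) : ℝ :=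
  -((x - zeta α β) / 2) * ProbabilityTheory.gaussianPDFReal 0 2 (x - zeta α β)

/-- `F₂' = -3 (1 + β*) Δ sgn (x - ζ) |x - ζ| ^ (Δ - 4)`, where `Δ = 2 - α`. -/
def F₂' (α β x : ℝ) : ℝ :=
  -3 * (1 + betaStar α β x) * (2 - α) *
    (Real.sign (x - zeta α β) * |x - zeta α β| ^ ((2 - α) - 4))

/-- The approximation `g' = F₁' + F₂'` of the derivative of the density (`g'` is a name: it is not
exactly the derivative of `g`). -/
def g' (α β x : ℝ) : ℝ := F₁' α β x + F₂' α β x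

/-- `g_σ = -g - (x - ζ) g'`. -/
def gScale (α β x : ℝ) : ℝ := -g α β x - (x - zeta α β) * g' α β x

/-- `F_σ^1 = (x - ζ)² / 2`. -/
def FScale₁ (α β x : ℝ) : ℝ := (x - zeta α β) ^ 2 / 2

/-- `F_σ^2 = 2`. -/
def FScale₂ : ℝ := 2

theorem norm_charFn (μ σ α β t : ℝ) : ‖charFn μ σ α β t‖ = Real.exp (-|σ * t| ^ α) := by
  unfold charFn
  rw [Complex.norm_exp]
  congr 1
  simp only [Complex.add_re, Complex.mul_re, Complex.neg_re, Complex.neg_im, Complex.ofReal_re,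
    Complex.ofReal_im, Complex.I_re, Complex.I_im, Complex.one_re]
  ring

/-- `density` is the density of the law with characteristic function `charFn`: a continuous
integrable function whose characteristic function is `charFn` equals `density`. -/
theorem eq_density_of_charFn {μ σ α β : ℝ} (hσ : 0 < σ) (hα : 0 < α) (p : ℝ → ℝ)
    (hc : Continuous p) (hi : Integrable p)
    (hp : ∀ t : ℝ, ∫ x : ℝ, Complex.exp (Complex.I * ((t * x : ℝ) : ℂ)) * (p x : ℂ)
      = charFn μ σ α β t) (x : ℝ) : p x = density μ σ α β x := by
  have hnorm : Integrable (fun t : ℝ => Real.exp (-|σ * t| ^ α)) := by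
    have h0 : IntegrableOn (fun t : ℝ => Real.exp (-|t| ^ α)) (Set.Ioi 0) := by
      have h := integrableOn_rpow_mul_exp_neg_rpow (s := 0) (p := α) (by norm_num) hα
      refine h.congr_fun (fun t ht => ?_) measurableSet_Ioi
      simp [abs_of_pos (Set.mem_Ioi.1 ht)]
    have h1 : Integrable (fun t : ℝ => Real.exp (-|t| ^ α)) := by
      rw [← integrableOn_univ, ← Set.Iic_union_Ioi (a := (0 : ℝ)), integrableOn_union]
      refine ⟨?_, h0⟩
      have h2 : IntegrableOn (fun t : ℝ => Real.exp (-|t| ^ α)) (Set.Ici 0) := by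
        rw [integrableOn_Ici_iff_integrableOn_Ioi]; exact h0
      have h3 : IntegrableOn (fun t : ℝ => Real.exp (-|-t| ^ α)) (Set.Iic 0) := by
        have h4 : IntegrableOn (fun t : ℝ => Real.exp (-|t| ^ α)) (Set.Ici (-0)) := by simpa using h2
        exact h4.comp_neg_Iic
      simpa using h3
    exact h1.comp_mul_left' hσ.ne'
  have hF : ∀ w : ℝ, FourierTransform.fourier (fun x : ℝ => (p x : ℂ)) w
      = charFn μ σ α β (-(2 * Real.pi) * w) := by
    intro w
    rw [← hp, Real.fourier_real_eq_integral_exp_smul]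
    refine integral_congr_ae (Filter.Eventually.of_forall fun v => ?_)
    simp only [smul_eq_mul]
    congr 2
    push_cast
    ring
  have hcont : Continuous (FourierTransform.fourier (fun x : ℝ => (p x : ℂ))) :=
    VectorFourier.fourierIntegral_continuous Real.continuous_fourierChar
      (L := innerₗ ℝ) continuous_inner hi.ofReal
  have hFint : Integrable (FourierTransform.fourier (fun x : ℝ => (p x : ℂ))) := by
    have h2 := hnorm.comp_mul_left' (R := -(2 * Real.pi)) (by simp [Real.pi_ne_zero])
    refine h2.mono' hcont.aestronglyMeasurable (Filter.Eventually.of_forall fun w => ?_)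
    rw [hF, norm_charFn]
  have hinv := Continuous.fourierInv_fourier_eq (f := fun x : ℝ => (p x : ℂ))
    (Complex.continuous_ofReal.comp hc) hi.ofReal hFint
  have hx := congrFun hinv x
  rw [Real.fourierInv_eq'] at hx
  have hcv := Measure.integral_comp_mul_left
    (fun t : ℝ => Complex.exp (-(Complex.I * ((t * x : ℝ) : ℂ))) * charFn μ σ α β t)
    (-(2 * Real.pi))
  have heq : (p x : ℂ) = ((1 / (2 * Real.pi) : ℝ) : ℂ) *
      ∫ t : ℝ, Complex.exp (-(Complex.I * ((t * x : ℝ) : ℂ))) * charFn μ σ α β t := by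
    have habs : |(-(2 * Real.pi))⁻¹| = 1 / (2 * Real.pi) := by
      rw [abs_inv, abs_neg, abs_of_pos (by positivity), one_div]
    rw [habs, Complex.real_smul] at hcv
    rw [← hcv, ← hx]
    refine integral_congr_ae (Filter.Eventually.of_forall fun v => ?_)
    simp only [hF, smul_eq_mul]
    congr 2
    simp only [RCLike.inner_apply, conj_trivial]
    push_cast
    ring
  unfold density
  rw [← Complex.re_ofReal_mul, ← heq, Complex.ofReal_re]

end Stable

end

/-! Let `h` be the standardised density `stdDensity`. The substitution `u = σt` in the inverse
Fourier integral gives `f(x;0,σ) = σ⁻¹ h(x/σ - ζ)`, so `f_σ = -h(y) - x h'(y)` with `y = x - ζ`.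
Both `h` and `h'` are real parts of one-sided integrals `∫ u^p exp(-iyu - (1+iζ)u^α) du` with `p =
0, 1`, up to constant factors.

The key estimate is `exists_halfFourier_expansion`. For `y ≥ 1` the ray of integration is turned by
the fixed angle `1/4`, where `exp(-iyt)` decays like `exp(-y u sin(1/4))` while the stable factor
stays bounded. There `exp(-w₁) - exp(-w₂)`, with `w₁` and `w₂` the stable and Gaussian exponents, is
replaced by `w₂ - w₁`. The remainder is at most `‖w₁ - w₂‖(‖w₁‖ + ‖w₂‖)`, and `w₁ - w₂` carries a
factor `Δ`, so the error is `O(Δ)` times a power of `y` smaller than the tail, uniformly in `Δ` and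
`y`. The linear terms are Gamma integrals; since `ζ = β tan(πΔ/2)`, their phases combine into the
factor `(1+β) sin(πΔ/2)`. Thus `h` is the exact Gaussian plus a tail `~ (1+β*)Δ|y|^(Δ-3)`, and `y
h'` is `-y²φ/2` minus three times that tail; negative `y` follows by reflection.

On the other side `g_σ = (y²/2 - 1)F₁ + 2F₂` (`gScale_eq`). For `|y| ≥ 2` both terms are positive,
so errors small relative to either one are small relative to `g_σ`; the mismatch `x h' - y h' = ζ
h'` is harmless because `|ζ| ≤ 2Δ`. This gives the first claim.

The other claims concern explicit functions only: `g_σ/g` is the average of `F_σ^1 - 1` and `F_σ^2`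
with weights `F₁` and `F₂`. The ratio `F₂/F₁` is of the order `Δ exp(y²/4)` up to powers of `|y|`,
which changes from small to large near `|y| = 2(log 1/Δ)^(1/2)`. -/

noncomputable section

namespace Stable

/-! ### Rotation of the ray of integration. -/

/-- The integrand of `∫ t ^ p exp (-A t - c t ^ α) dt` along the ray `t = u exp (-iθ)`. -/
def rayIntegrand (p α : ℝ) (A c : ℂ) (θ u : ℝ) : ℂ :=
  ((u ^ p : ℝ) : ℂ) * Complex.exp (-(Complex.I * ((p + 1 : ℝ) : ℂ) * θ)
    - A * u * Complex.exp (-(Complex.I * θ))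
    - c * ((u ^ α : ℝ) : ℂ) * Complex.exp (-(Complex.I * α * θ)))

/-- The logarithmic derivative of `u * rayIntegrand p α A c θ u` in `log u`. -/
def rayFactor (p α : ℝ) (A c : ℂ) (θ u : ℝ) : ℂ :=
  ((p + 1 : ℝ) : ℂ) - A * u * Complex.exp (-(Complex.I * θ))
    - α * c * ((u ^ α : ℝ) : ℂ) * Complex.exp (-(Complex.I * α * θ))

/-- With `t = u exp(-iθ)`, the product `u * rayIntegrand` is `t^(p+1) exp(-At - ct^α)`, a
holomorphic function of `log t = log u - iθ`. Hence the derivative in `θ` is `-i` times the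
derivative in `log u`: these are the Cauchy–Riemann equations in logarithmic polar coordinates. The
angular derivative of the integral is therefore the integral of a total derivative in `u`. -/
theorem hasDerivAt_rayIntegrand_angle (p α : ℝ) (A c : ℂ) (θ u : ℝ) :
    HasDerivAt (fun θ : ℝ => rayIntegrand p α A c θ u)
      (-Complex.I * (rayFactor p α A c θ u * rayIntegrand p α A c θ u)) θ := by
  have hid : HasDerivAt (fun θ : ℝ => (θ : ℂ)) 1 θ := Complex.ofRealCLM.hasDerivAt
  have h1 : HasDerivAt (fun θ : ℝ => -(Complex.I * ((p + 1 : ℝ) : ℂ) * θ))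
      (-(Complex.I * ((p + 1 : ℝ) : ℂ))) θ := by
    simpa only [mul_one] using! (hid.const_mul (Complex.I * ((p + 1 : ℝ) : ℂ))).neg
  have h2 : HasDerivAt (fun θ : ℝ => Complex.exp (-(Complex.I * θ)))
      (Complex.exp (-(Complex.I * θ)) * -Complex.I) θ := by
    simpa only [mul_one] using! (hid.const_mul Complex.I).neg.cexp
  have h3 : HasDerivAt (fun θ : ℝ => Complex.exp (-(Complex.I * α * θ)))
      (Complex.exp (-(Complex.I * α * θ)) * -(Complex.I * α)) θ := by
    simpa only [mul_one] using! (hid.const_mul (Complex.I * α)).neg.cexp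
  have h := (((h1.sub (h2.const_mul (A * u))).sub
    (h3.const_mul (c * ((u ^ α : ℝ) : ℂ)))).cexp).const_mul ((u ^ p : ℝ) : ℂ)
  refine h.congr_deriv ?_
  simp only [rayFactor, rayIntegrand, Pi.sub_apply]
  ring

theorem hasDerivAt_mul_rayIntegrand (p α : ℝ) (A c : ℂ) (θ : ℝ) {u : ℝ} (hu : 0 < u) :
    HasDerivAt (fun u : ℝ => (u : ℂ) * rayIntegrand p α A c θ u)
      (rayFactor p α A c θ u * rayIntegrand p α A c θ u) u := by
  have hid : HasDerivAt (fun u : ℝ => (u : ℂ)) 1 u := Complex.ofRealCLM.hasDerivAt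
  have hp : HasDerivAt (fun u : ℝ => ((u ^ p : ℝ) : ℂ)) ((p * u ^ (p - 1) : ℝ) : ℂ) u :=
    (Real.hasDerivAt_rpow_const (Or.inl hu.ne')).ofReal_comp
  have hα : HasDerivAt (fun u : ℝ => ((u ^ α : ℝ) : ℂ)) ((α * u ^ (α - 1) : ℝ) : ℂ) u :=
    (Real.hasDerivAt_rpow_const (Or.inl hu.ne')).ofReal_comp
  have hp' : ((u * u ^ (p - 1) : ℝ) : ℂ) = ((u ^ p : ℝ) : ℂ) := by
    rw [Real.rpow_sub_one hu.ne']; field_simp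
  have hα' : ((u * u ^ (α - 1) : ℝ) : ℂ) = ((u ^ α : ℝ) : ℂ) := by
    rw [Real.rpow_sub_one hu.ne']; field_simp
  have h1 : HasDerivAt (fun u : ℝ => -(Complex.I * ((p + 1 : ℝ) : ℂ) * θ)
      - A * u * Complex.exp (-(Complex.I * θ))
      - c * ((u ^ α : ℝ) : ℂ) * Complex.exp (-(Complex.I * α * θ)))
      (-(A * 1 * Complex.exp (-(Complex.I * θ)))
      - c * ((α * u ^ (α - 1) : ℝ) : ℂ) * Complex.exp (-(Complex.I * α * θ))) u :=
    (((hid.const_mul A).mul_const _).const_sub _).sub ((hα.const_mul c).mul_const _)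
  have h := hid.mul (hp.mul h1.cexp)
  refine h.congr_deriv ?_
  simp only [rayFactor, rayIntegrand, Pi.mul_apply]
  rw [← hp', ← hα']
  push_cast
  ring

theorem norm_rayIntegrand (p α : ℝ) (A c : ℂ) (θ : ℝ) {u : ℝ} (hu : 0 < u) :
    ‖rayIntegrand p α A c θ u‖ = u ^ p * Real.exp (-(A * u * Complex.exp (-(Complex.I * θ))
      + c * ((u ^ α : ℝ) : ℂ) * Complex.exp (-(Complex.I * α * θ))).re) := by
  rw [rayIntegrand, norm_mul, Complex.norm_exp, Complex.norm_real, Real.norm_of_nonneg (by positivity)]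
  congr 2
  simp only [Complex.sub_re, Complex.add_re, Complex.neg_re]
  have : (Complex.I * ((p + 1 : ℝ) : ℂ) * θ).re = 0 := by
    simp [Complex.mul_re]
  rw [this]
  ring

theorem norm_exp_neg_I_mul (x : ℝ) : ‖Complex.exp (-(Complex.I * x))‖ = 1 := by
  rw [Complex.norm_exp]; simp

theorem norm_rayFactor_le {p α : ℝ} (hp : -1 < p) (hα : 0 < α) (A c : ℂ) (θ : ℝ) {u : ℝ}
    (hu : 0 < u) : ‖rayFactor p α A c θ u‖ ≤ (p + 1) + ‖A‖ * u + α * ‖c‖ * u ^ α := by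
  have h2 : ‖Complex.exp (-(Complex.I * α * θ))‖ = 1 := by
    rw [mul_assoc, ← Complex.ofReal_mul, norm_exp_neg_I_mul]
  refine (norm_sub_le _ _).trans (add_le_add ((norm_sub_le _ _).trans (add_le_add ?_ ?_)) ?_)
  · rw [Complex.norm_real, Real.norm_of_nonneg (by linarith)]
  · rw [norm_mul, norm_mul, norm_exp_neg_I_mul, Complex.norm_real, Real.norm_of_nonneg hu.le, mul_one]
  · rw [norm_mul, norm_mul, norm_mul, h2, Complex.norm_real, Complex.norm_real,
      Real.norm_of_nonneg hα.le, Real.norm_of_nonneg (by positivity), mul_one]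

theorem continuousOn_rayIntegrand (p α : ℝ) (A c : ℂ) (θ : ℝ) :
    ContinuousOn (rayIntegrand p α A c θ) (Set.Ioi 0) := by
  have h (q : ℝ) : ContinuousOn (fun u : ℝ => ((u ^ q : ℝ) : ℂ)) (Set.Ioi 0) := fun u hu =>
    (Complex.continuous_ofReal.continuousAt.comp
      (Real.continuousAt_rpow_const u q (Or.inl (Set.mem_Ioi.1 hu).ne'))).continuousWithinAt
  unfold rayIntegrand
  have h1 := h p
  have h2 := h α
  fun_prop

theorem continuousOn_rayFactor (p α : ℝ) (A c : ℂ) (θ : ℝ) :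
    ContinuousOn (rayFactor p α A c θ) (Set.Ioi 0) := by
  have h2 : ContinuousOn (fun u : ℝ => ((u ^ α : ℝ) : ℂ)) (Set.Ioi 0) := fun u hu =>
    (Complex.continuous_ofReal.continuousAt.comp
      (Real.continuousAt_rpow_const u α (Or.inl (Set.mem_Ioi.1 hu).ne'))).continuousWithinAt
  unfold rayFactor
  fun_prop

section rotation

variable {p α q κ C : ℝ} {A c : ℂ}

theorem norm_rayIntegrand_le {θ u : ℝ} (hu : 0 < u)
    (hb : κ * u ^ q - C ≤ (A * u * Complex.exp (-(Complex.I * θ))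
      + c * ((u ^ α : ℝ) : ℂ) * Complex.exp (-(Complex.I * α * θ))).re) :
    ‖rayIntegrand p α A c θ u‖ ≤ Real.exp C * (u ^ p * Real.exp (-κ * u ^ q)) := by
  rw [norm_rayIntegrand p α A c θ hu, mul_left_comm, ← Real.exp_add]
  gcongr
  linarith

theorem integrableOn_rayIntegrand {θ : ℝ} (hp : -1 < p) (hq : 0 < q) (hκ : 0 < κ)
    (hb : ∀ u : ℝ, 0 < u → κ * u ^ q - C ≤ (A * u * Complex.exp (-(Complex.I * θ))
      + c * ((u ^ α : ℝ) : ℂ) * Complex.exp (-(Complex.I * α * θ))).re) :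
    IntegrableOn (rayIntegrand p α A c θ) (Set.Ioi 0) := by
  refine Integrable.mono' (((integrableOn_rpow_mul_exp_neg_mul_rpow hp hq hκ)).const_mul (Real.exp C))
    ((continuousOn_rayIntegrand p α A c θ).aestronglyMeasurable measurableSet_Ioi) ?_
  filter_upwards [ae_restrict_mem measurableSet_Ioi] with u hu
  exact norm_rayIntegrand_le hu (hb u hu)

/-- Rotating the ray of integration does not change the integral as long as the integrand decays. -/
theorem integral_rayIntegrand_eq (hp : -1 < p) (hα : 0 < α) (hq : 0 < q) (hκ : 0 < κ) {a b : ℝ}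
    (hb : ∀ θ ∈ Set.Ioo a b, ∀ u : ℝ, 0 < u →
      κ * u ^ q - C ≤ (A * u * Complex.exp (-(Complex.I * θ))
        + c * ((u ^ α : ℝ) : ℂ) * Complex.exp (-(Complex.I * α * θ))).re)
    {θ₁ θ₂ : ℝ} (h₁ : θ₁ ∈ Set.Ioo a b) (h₂ : θ₂ ∈ Set.Ioo a b) :
    ∫ u in Set.Ioi 0, rayIntegrand p α A c θ₁ u = ∫ u in Set.Ioi 0, rayIntegrand p α A c θ₂ u := by
  set B : ℝ → ℝ := fun u => Real.exp C * ((p + 1) * (u ^ p * Real.exp (-κ * u ^ q))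
    + ‖A‖ * (u ^ (p + 1) * Real.exp (-κ * u ^ q))
    + α * ‖c‖ * (u ^ (p + α) * Real.exp (-κ * u ^ q))) with hB
  have hBint : IntegrableOn B (Set.Ioi 0) := by
    refine Integrable.const_mul (Integrable.add (Integrable.add ?_ ?_) ?_) _
    · exact (integrableOn_rpow_mul_exp_neg_mul_rpow hp hq hκ).const_mul _
    · exact (integrableOn_rpow_mul_exp_neg_mul_rpow (by linarith) hq hκ).const_mul _
    · exact (integrableOn_rpow_mul_exp_neg_mul_rpow (by linarith) hq hκ).const_mul _
  have hbound : ∀ θ ∈ Set.Ioo a b, ∀ u ∈ Set.Ioi (0 : ℝ),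
      ‖rayFactor p α A c θ u * rayIntegrand p α A c θ u‖ ≤ B u := by
    intro θ hθ u hu
    have hu : 0 < u := hu
    rw [norm_mul]
    refine (mul_le_mul (norm_rayFactor_le hp hα A c θ hu) (norm_rayIntegrand_le hu (hb θ hθ u hu))
      (norm_nonneg _) (by have : 0 < p + 1 := by linarith
                          positivity)).trans (le_of_eq ?_)
    simp only [hB]
    rw [Real.rpow_add hu, Real.rpow_add hu, Real.rpow_one]
    ring
  have hmeas (θ : ℝ) : AEStronglyMeasurable
      (fun u => rayFactor p α A c θ u * rayIntegrand p α A c θ u) (volume.restrict (Set.Ioi 0)) :=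
    ((continuousOn_rayFactor p α A c θ).mul (continuousOn_rayIntegrand p α A c θ)).aestronglyMeasurable
      measurableSet_Ioi
  have hzero : ∀ θ ∈ Set.Ioo a b,
      ∫ u in Set.Ioi 0, rayFactor p α A c θ u * rayIntegrand p α A c θ u = 0 := by
    intro θ hθ
    have hle : ∀ u ∈ Set.Ioi (0 : ℝ), ‖(u : ℂ) * rayIntegrand p α A c θ u‖
        ≤ Real.exp C * (u ^ (p + 1) * Real.exp (-κ * u ^ q)) := by
      intro u hu
      have hu : 0 < u := hu
      rw [norm_mul, Complex.norm_real, Real.norm_of_nonneg hu.le]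
      refine (mul_le_mul_of_nonneg_left (norm_rayIntegrand_le hu (hb θ hθ u hu)) hu.le).trans
        (le_of_eq ?_)
      rw [Real.rpow_add hu, Real.rpow_one]
      ring
    -- The boundary terms of the total derivative vanish: at infinity by the decay hypothesis, at
    -- `0` because `p + 1 > 0`.
    have htop : Filter.Tendsto (fun u : ℝ => (u : ℂ) * rayIntegrand p α A c θ u) Filter.atTop
        (nhds 0) := by
      refine squeeze_zero_norm' (Filter.eventually_atTop.2 ⟨1, fun u hu => hle u
        (lt_of_lt_of_le one_pos hu)⟩) ?_
      have h := (tendsto_rpow_mul_exp_neg_mul_atTop_nhds_zero ((p + 1) / q) κ hκ).comp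
        (tendsto_rpow_atTop hq)
      have h' := h.const_mul (Real.exp C)
      rw [mul_zero] at h'
      refine h'.congr' ?_
      filter_upwards [Filter.eventually_gt_atTop 0] with u hu
      simp only [Function.comp]
      rw [← Real.rpow_mul hu.le]
      congr 3
      field_simp
    have hbot : Filter.Tendsto (fun u : ℝ => (u : ℂ) * rayIntegrand p α A c θ u)
        (nhdsWithin 0 (Set.Ioi 0)) (nhds 0) := by
      have h1 : Filter.Tendsto (fun u : ℝ => Real.exp C * u ^ (p + 1))
          (nhdsWithin 0 (Set.Ioi 0)) (nhds 0) := by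
        have h : ContinuousAt (fun u : ℝ => Real.exp C * u ^ (p + 1)) 0 :=
          (Real.continuousAt_rpow_const 0 _ (Or.inr (by linarith))).const_mul _
        have h2 := h.tendsto
        simp only [Real.zero_rpow (show p + 1 ≠ 0 by linarith), mul_zero] at h2
        exact h2.mono_left nhdsWithin_le_nhds
      refine squeeze_zero_norm' ?_ h1
      filter_upwards [self_mem_nhdsWithin] with u hu
      have hu : 0 < u := hu
      refine (hle u hu).trans ?_
      gcongr
      refine mul_le_of_le_one_right (by positivity) (Real.exp_le_one_iff.2 ?_)
      have : 0 < κ * u ^ q := by positivity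
      linarith
    have hcont : ContinuousWithinAt (fun u : ℝ => (u : ℂ) * rayIntegrand p α A c θ u)
        (Set.Ici 0) 0 := by
      rw [← continuousWithinAt_Ioi_iff_Ici, ContinuousWithinAt]
      simpa using hbot
    have h := integral_Ioi_of_hasDerivAt_of_tendsto hcont
      (fun u hu => hasDerivAt_mul_rayIntegrand p α A c θ hu)
      (hBint.mono' (hmeas θ) ((ae_restrict_mem measurableSet_Ioi).mono (hbound θ hθ))) htop
    simpa using h
  have hderiv : ∀ θ ∈ Set.Ioo a b,
      HasDerivAt (fun θ => ∫ u in Set.Ioi 0, rayIntegrand p α A c θ u) 0 θ := by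
    intro θ hθ
    have h := (hasDerivAt_integral_of_dominated_loc_of_deriv_le (μ := volume.restrict (Set.Ioi 0))
      (F := fun θ u => rayIntegrand p α A c θ u) (x₀ := θ) (bound := B)
      (F' := fun θ u => -Complex.I * (rayFactor p α A c θ u * rayIntegrand p α A c θ u))
      (Ioo_mem_nhds hθ.1 hθ.2)
      (Filter.Eventually.of_forall fun θ =>
        (continuousOn_rayIntegrand p α A c θ).aestronglyMeasurable measurableSet_Ioi)
      (integrableOn_rayIntegrand hp hq hκ (hb θ hθ))
      ((hmeas θ).const_mul _)
      (by
        filter_upwards [ae_restrict_mem measurableSet_Ioi] with u hu θ hθ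
        rw [norm_mul, norm_neg, Complex.norm_I, one_mul]
        exact hbound θ hθ u hu)
      hBint
      (Filter.Eventually.of_forall fun u θ _ => hasDerivAt_rayIntegrand_angle p α A c θ u)).2
    refine h.congr_deriv ?_
    rw [integral_const_mul, hzero θ hθ, mul_zero]
  exact isOpen_Ioo.is_const_of_deriv_eq_zero isPreconnected_Ioo
    (fun θ hθ => (hderiv θ hθ).differentiableAt.differentiableWithinAt)
    (fun θ hθ => (hderiv θ hθ).deriv) h₁ h₂

end rotation

/-! ### One-sided Fourier integrals and their rotation. -/

/-- The one-sided Fourier integral `∫ u ^ p exp (-i y u - (1 + i ζ) u ^ α) du` over `u > 0`. -/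
def halfFourier (p ζ α y : ℝ) : ℂ :=
  ∫ u in Set.Ioi (0 : ℝ), ((u ^ p : ℝ) : ℂ) * Complex.exp (-(Complex.I * y * u)
    - (1 + ζ * Complex.I) * ((u ^ α : ℝ) : ℂ))

theorem halfFourier_eq_ray_zero (p ζ α y : ℝ) : halfFourier p ζ α y
    = ∫ u in Set.Ioi 0, rayIntegrand p α (Complex.I * y) (1 + ζ * Complex.I) 0 u := by
  simp [halfFourier, rayIntegrand]

theorem exists_mul_sub_rpow_le {α : ℝ} (hα : 1 < α) (y : ℝ) :
    ∃ C : ℝ, ∀ u : ℝ, 0 < u → |y| * u - u ^ α / 8 ≤ C := by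
  -- At `u = (8|y|)^(1/(α-1))` the two terms balance; beyond it the difference is nonpositive, and
  -- before it `|y| u` alone is bounded by this value.
  refine ⟨|y| * (8 * |y|) ^ (1 / (α - 1)), fun u hu => ?_⟩
  have hα' : 0 < α - 1 := by linarith
  rcases le_total (8 * |y|) (u ^ (α - 1)) with h | h
  · have h1 : u ^ α = u ^ (α - 1) * u := by
      rw [← Real.rpow_add_one hu.ne']; ring_nf
    have h2 : 0 ≤ |y| * (8 * |y|) ^ (1 / (α - 1)) := by positivity
    nlinarith
  · have h1 : u ≤ (8 * |y|) ^ (1 / (α - 1)) := by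
      have := Real.rpow_le_rpow (by positivity) h (one_div_pos.2 hα').le
      rwa [← Real.rpow_mul hu.le, mul_one_div_cancel hα'.ne', Real.rpow_one] at this
    have h2 : 0 < u ^ α := by positivity
    have h3 := mul_le_mul_of_nonneg_left h1 (abs_nonneg y)
    linarith

theorem exp_neg_I_mul_re (x : ℝ) : (Complex.exp (-(Complex.I * x))).re = Real.cos x := by
  simp [Complex.exp_re]

theorem exp_neg_I_mul_im (x : ℝ) : (Complex.exp (-(Complex.I * x))).im = -Real.sin x := by
  simp [Complex.exp_im]

theorem re_I_mul_exp (y u θ : ℝ) :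
    (Complex.I * y * u * Complex.exp (-(Complex.I * θ))).re = y * u * Real.sin θ := by
  simp [Complex.mul_re, Complex.mul_im, exp_neg_I_mul_re, exp_neg_I_mul_im]

theorem re_stable_exponent (ζ v φ : ℝ) :
    ((1 + ζ * Complex.I) * v * Complex.exp (-(Complex.I * φ))).re
      = v * (Real.cos φ + ζ * Real.sin φ) := by
  simp [Complex.mul_re, Complex.mul_im, exp_neg_I_mul_re, exp_neg_I_mul_im]
  ring

theorem quarter_le_cos_add_mul_sin {ζ φ : ℝ} (hζ : |ζ| ≤ 1 / 4) (hφ : |φ| ≤ 1) :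
    1 / 4 ≤ Real.cos φ + ζ * Real.sin φ := by
  have h1 : 1 / 2 ≤ Real.cos φ := by
    have := Real.one_sub_sq_div_two_le_cos (x := φ)
    have h2 : φ ^ 2 ≤ 1 := by rw [← sq_abs]; nlinarith [abs_nonneg φ]
    linarith
  have h2 : |ζ * Real.sin φ| ≤ 1 / 4 := by
    rw [abs_mul]
    have := Real.abs_sin_le_one φ
    nlinarith [abs_nonneg ζ, abs_nonneg (Real.sin φ)]
  have := neg_le_of_abs_le h2
  linarith

/-- For `|θ| < 1/2` and `α ≤ 2` the phase `αθ` stays in `[-1, 1]`, so the stable term contributes at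
least `u^α/4`. Half of this absorbs the possibly growing linear term. The constant depends on `y`,
which is harmless since it only justifies the rotation. -/
theorem exists_decay {α ζ : ℝ} (hα : 1 < α) (hα2 : α ≤ 2) (hζ : |ζ| ≤ 1 / 4) (y : ℝ) :
    ∃ C : ℝ, ∀ θ ∈ Set.Ioo (-(1 / 2) : ℝ) (1 / 2), ∀ u : ℝ, 0 < u →
      1 / 8 * u ^ α - C ≤ (Complex.I * y * u * Complex.exp (-(Complex.I * θ))
        + (1 + ζ * Complex.I) * ((u ^ α : ℝ) : ℂ) * Complex.exp (-(Complex.I * α * θ))).re := by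
  obtain ⟨C, hC⟩ := exists_mul_sub_rpow_le hα y
  refine ⟨C, fun θ hθ u hu => ?_⟩
  have hθ' : |θ| < 1 / 2 := abs_lt.2 hθ
  have hφ : |α * θ| ≤ 1 := by
    rw [abs_mul, abs_of_pos (by linarith)]
    nlinarith [abs_nonneg θ]
  have h1 := quarter_le_cos_add_mul_sin hζ hφ
  have h2 : 0 < u ^ α := by positivity
  have h3 := hC u hu
  have h4 : -(|y| * u) ≤ y * u * Real.sin θ := by
    have : |y * u * Real.sin θ| ≤ |y| * u := by
      rw [abs_mul, abs_mul, abs_of_pos hu]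
      exact mul_le_of_le_one_right (by positivity) (Real.abs_sin_le_one θ)
    exact neg_le_of_abs_le this
  rw [Complex.add_re, re_I_mul_exp, mul_assoc Complex.I, ← Complex.ofReal_mul, re_stable_exponent]
  nlinarith

theorem halfFourier_eq_ray {p ζ α : ℝ} (hp : -1 < p) (hα : 1 < α) (hα2 : α ≤ 2)
    (hζ : |ζ| ≤ 1 / 4) (y : ℝ) : halfFourier p ζ α y
    = ∫ u in Set.Ioi 0, rayIntegrand p α (Complex.I * y) (1 + ζ * Complex.I) (1 / 4) u := by
  obtain ⟨C, hC⟩ := exists_decay hα hα2 hζ y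
  rw [halfFourier_eq_ray_zero]
  exact integral_rayIntegrand_eq hp (by linarith) (q := α) (κ := 1 / 8) (by linarith) (by norm_num)
    hC (by norm_num) (by norm_num)

theorem re_mul_exp_neg_I (y u φ : ℝ) :
    ((y : ℂ) * u * Complex.exp (-(Complex.I * φ))).re = y * u * Real.cos φ := by
  simp [Complex.mul_re, Complex.mul_im, exp_neg_I_mul_re, exp_neg_I_mul_im]

/-- On the ray at angle `π/2` the factor `exp(-iyt)` becomes the real exponential `exp(-yu)`, and
the integral is Euler's. Every angle in `(0, π)` gives the same value, which is how the oscillatory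
power integrals acquire one. -/
theorem integral_rayIntegrand_gamma {p : ℝ} (hp : -1 < p) {y : ℝ} (hy : 0 < y) {θ : ℝ}
    (hθ : θ ∈ Set.Ioo 0 Real.pi) :
    ∫ u in Set.Ioi 0, rayIntegrand p 1 (Complex.I * y) 0 θ u
      = ((y ^ (-(p + 1)) * Real.Gamma (p + 1) : ℝ) : ℂ)
        * Complex.exp (-(Complex.I * ((p + 1 : ℝ) : ℂ) * ((Real.pi / 2 : ℝ) : ℂ))) := by
  have hshift : ∀ u : ℝ, rayIntegrand p 1 (Complex.I * y) 0 θ u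
      = Complex.exp (-(Complex.I * ((p + 1 : ℝ) : ℂ) * ((Real.pi / 2 : ℝ) : ℂ)))
        * rayIntegrand p 1 y 0 (θ - Real.pi / 2) u := by
    intro u
    have h1 : Complex.exp (-(Complex.I * ((θ - Real.pi / 2 : ℝ) : ℂ)))
        = Complex.I * Complex.exp (-(Complex.I * θ)) := by
      have : -(Complex.I * ((θ - Real.pi / 2 : ℝ) : ℂ))
          = (Real.pi / 2 : ℂ) * Complex.I + -(Complex.I * θ) := by push_cast; ring
      rw [this, Complex.exp_add, Complex.exp_pi_div_two_mul_I]
    unfold rayIntegrand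
    rw [h1, mul_left_comm, ← Complex.exp_add]
    congr 2
    push_cast
    ring
  -- Halfway between `|θ - π/2|` and `π/2`, so that the cosine is bounded below by `cos b > 0` on
  -- the whole interval of angles used.
  set b : ℝ := (|θ - Real.pi / 2| + Real.pi / 2) / 2 with hb
  have hφ : |θ - Real.pi / 2| < Real.pi / 2 := by
    rw [abs_lt]; constructor <;> linarith [hθ.1, hθ.2]
  have hb0 : 0 < b := by have := abs_nonneg (θ - Real.pi / 2); have := Real.pi_pos; positivity
  have hb1 : b < Real.pi / 2 := by linarith
  have hcosb : 0 < Real.cos b := Real.cos_pos_of_mem_Ioo ⟨by linarith, hb1⟩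
  have hdecay : ∀ φ ∈ Set.Ioo (-b) b, ∀ u : ℝ, 0 < u →
      y * Real.cos b * u ^ (1 : ℝ) - 0 ≤ ((y : ℂ) * u * Complex.exp (-(Complex.I * φ))
        + 0 * ((u ^ (1 : ℝ) : ℝ) : ℂ) * Complex.exp (-(Complex.I * ((1 : ℝ) : ℂ) * φ))).re := by
    intro φ hφ u hu
    rw [zero_mul, zero_mul, add_zero, re_mul_exp_neg_I, Real.rpow_one, sub_zero,
      ← Real.cos_abs φ, mul_right_comm]
    gcongr
    exact Real.cos_le_cos_of_nonneg_of_le_pi (abs_nonneg _) (by linarith) (abs_lt.2 hφ).le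
  have hrot := integral_rayIntegrand_eq (p := p) (α := 1) (q := 1) (A := (y : ℂ)) (c := 0) hp
    one_pos one_pos (by positivity) hdecay (θ₁ := θ - Real.pi / 2) (θ₂ := 0)
    (abs_lt.1 (show |θ - Real.pi / 2| < b by linarith)) ⟨by linarith, hb0⟩
  simp_rw [hshift]
  rw [integral_const_mul, hrot, mul_comm]
  congr 1
  have hΓ := Real.integral_rpow_mul_exp_neg_mul_Ioi (a := p + 1) (r := y) (by linarith) hy
  rw [show (1 / y) ^ (p + 1) = y ^ (-(p + 1)) by
    rw [one_div, Real.inv_rpow hy.le, Real.rpow_neg hy.le]] at hΓ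
  rw [← hΓ, ← integral_complex_ofReal]
  refine integral_congr_ae (Filter.Eventually.of_forall fun u => ?_)
  simp [rayIntegrand]

/-! ### Comparison of the stable and Gaussian exponents. -/

theorem norm_exp_neg_sub_exp_neg_le {w₁ w₂ : ℂ} (h₁ : 0 ≤ w₁.re) (h₂ : 0 ≤ w₂.re) :
    ‖Complex.exp (-w₁) - Complex.exp (-w₂)‖ ≤ ‖w₁ - w₂‖ := by
  have h := Convex.norm_image_sub_le_of_norm_hasDerivWithin_le (𝕜 := ℂ)
    (f := fun w : ℂ => Complex.exp (-w)) (f' := fun w => -Complex.exp (-w)) (C := 1)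
    (s := {w : ℂ | 0 ≤ w.re}) (x := w₂) (y := w₁)
    (fun w _ => by simpa using ((hasDerivAt_neg w).cexp).hasDerivWithinAt)
    (fun w hw => by
      rw [norm_neg, Complex.norm_exp, Real.exp_le_one_iff, Complex.neg_re]
      exact neg_nonpos.2 hw)
    (convex_halfSpace_re_ge 0) h₂ h₁
  simpa using h

/-- The mean value inequality for `exp(-w) + w`, whose derivative `1 - exp(-w)` has norm at most
`‖w‖` on the right half-plane. The factor `‖w₁ - w₂‖` is what preserves the smallness in `Δ` in the
second-order error. -/
theorem norm_exp_neg_sub_exp_neg_add_sub_le {w₁ w₂ : ℂ} (h₁ : 0 ≤ w₁.re) (h₂ : 0 ≤ w₂.re) :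
    ‖Complex.exp (-w₁) - Complex.exp (-w₂) - (w₂ - w₁)‖ ≤ ‖w₁ - w₂‖ * (‖w₁‖ + ‖w₂‖) := by
  have hconv : Convex ℝ ({w : ℂ | 0 ≤ w.re} ∩ Metric.closedBall 0 (‖w₁‖ + ‖w₂‖)) :=
    (convex_halfSpace_re_ge 0).inter (convex_closedBall _ _)
  have h := Convex.norm_image_sub_le_of_norm_hasDerivWithin_le (𝕜 := ℂ)
    (f := fun w : ℂ => Complex.exp (-w) + w) (f' := fun w => -Complex.exp (-w) + 1)
    (C := ‖w₁‖ + ‖w₂‖)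
    (s := {w : ℂ | 0 ≤ w.re} ∩ Metric.closedBall 0 (‖w₁‖ + ‖w₂‖)) (x := w₂) (y := w₁)
    (fun w _ => by
      have := (((hasDerivAt_neg w).cexp).add (hasDerivAt_id w)).hasDerivWithinAt
        (s := {w : ℂ | 0 ≤ w.re} ∩ Metric.closedBall 0 (‖w₁‖ + ‖w₂‖))
      simpa only [mul_neg, mul_one] using! this)
    (fun w hw => by
      have := norm_exp_neg_sub_exp_neg_le hw.1 (w₂ := 0) (by simp)
      rw [neg_zero, Complex.exp_zero, sub_zero] at this
      rw [show -Complex.exp (-w) + 1 = -(Complex.exp (-w) - 1) by ring, norm_neg]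
      exact this.trans (by simpa using hw.2))
    hconv ⟨h₂, by simp⟩ ⟨h₁, by simp⟩
  rw [mul_comm, show Complex.exp (-w₁) - Complex.exp (-w₂) - (w₂ - w₁)
    = Complex.exp (-w₁) + w₁ - (Complex.exp (-w₂) + w₂) by ring]
  exact h

theorem abs_rpow_sub_rpow_le {u : ℝ} (hu : 0 < u) (s t : ℝ) :
    |u ^ s - u ^ t| ≤ |s - t| * |Real.log u| * (u ^ s + u ^ t) := by
  wlog hst : u ^ s ≤ u ^ t generalizing s t
  · rw [abs_sub_comm, abs_sub_comm s, add_comm]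
    exact this t s (le_of_not_ge hst)
  rw [abs_of_nonpos (by linarith)]
  have h1 : u ^ s = u ^ t * u ^ (s - t) := by rw [← Real.rpow_add hu]; ring_nf
  have h2 : 1 - |s - t| * |Real.log u| ≤ u ^ (s - t) := by
    rw [Real.rpow_def_of_pos hu]
    have := Real.add_one_le_exp (Real.log u * (s - t))
    have h3 := neg_abs_le (Real.log u * (s - t))
    rw [abs_mul] at h3
    linarith
  have ht : 0 < u ^ t := by positivity
  have hs : 0 < u ^ s := by positivity
  have h4 : 0 ≤ |s - t| * |Real.log u| := by positivity
  nlinarith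

/-- Replaces the logarithm by powers, so that every error term becomes a Gamma integral; the
exponent `-1/2` at small `u` is mild enough to leave the final power of `y` unharmed. -/
theorem abs_log_le {u : ℝ} (hu : 0 < u) : |Real.log u| ≤ u + 2 * u ^ (-(1 / 2) : ℝ) := by
  have h1 : Real.log u ≤ u := (Real.log_le_sub_one_of_pos hu).trans (by linarith)
  have h2 := Real.log_le_rpow_div (x := u⁻¹) (ε := 1 / 2) (by positivity) (by norm_num)
  rw [Real.log_inv, Real.inv_rpow hu.le, ← Real.rpow_neg hu.le] at h2
  have h3 : 0 < u ^ (-(1 / 2) : ℝ) := by positivity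
  rw [abs_le]
  constructor <;> linarith

/-- The exponents differ in the skewness `ζ`, in the power of `u`, and in the phase after rotation.
Each difference is `O(Δ)`; only the power costs a logarithm. -/
theorem norm_stable_exponent_sub_le {Δ ζ u : ℝ} (hΔ : 0 < Δ) (hζ : |ζ| ≤ 2 * Δ)
    (hu : 0 < u) :
    ‖(1 + ζ * Complex.I) * ((u ^ (2 - Δ) : ℝ) : ℂ)
        * Complex.exp (-(Complex.I * ((2 - Δ : ℝ) : ℂ) * ((1 / 4 : ℝ) : ℂ)))
      - (1 + (0 : ℝ) * Complex.I) * ((u ^ (2 : ℝ) : ℝ) : ℂ)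
        * Complex.exp (-(Complex.I * ((2 : ℝ) : ℂ) * ((1 / 4 : ℝ) : ℂ)))‖
      ≤ 2 * Δ * ((u ^ (2 - Δ) + u ^ (2 : ℝ)) * (1 + u + u ^ (-(1 / 2) : ℝ))) := by
  set e₁ := Complex.exp (-(Complex.I * ((2 - Δ : ℝ) : ℂ) * ((1 / 4 : ℝ) : ℂ))) with he₁
  set e₂ := Complex.exp (-(Complex.I * ((2 : ℝ) : ℂ) * ((1 / 4 : ℝ) : ℂ))) with he₂
  have hn₁ : ‖e₁‖ = 1 := by
    rw [he₁, mul_assoc, ← Complex.ofReal_mul, norm_exp_neg_I_mul]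
  have hd : ‖e₁ - e₂‖ ≤ Δ := by
    refine (norm_exp_neg_sub_exp_neg_le ?_ ?_).trans ?_
    · rw [mul_assoc, ← Complex.ofReal_mul]; simp
    · rw [mul_assoc, ← Complex.ofReal_mul]; simp
    · rw [show Complex.I * ((2 - Δ : ℝ) : ℂ) * ((1 / 4 : ℝ) : ℂ)
        - Complex.I * ((2 : ℝ) : ℂ) * ((1 / 4 : ℝ) : ℂ) = Complex.I * ((-Δ / 4 : ℝ) : ℂ) by
          push_cast; ring, norm_mul, Complex.norm_I, one_mul, Complex.norm_real, Real.norm_eq_abs,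
          neg_div, abs_neg, abs_of_pos (by positivity)]
      linarith
  have hA : 0 < u ^ (2 - Δ) := by positivity
  have hB : 0 < u ^ (2 : ℝ) := by positivity
  have hr : 0 < u ^ (-(1 / 2) : ℝ) := by positivity
  have hdiff := abs_rpow_sub_rpow_le hu (2 - Δ) 2
  rw [show (2 : ℝ) - Δ - 2 = -Δ by ring, abs_neg, abs_of_pos hΔ] at hdiff
  have hlog := abs_log_le hu
  have hsplit : (1 + ζ * Complex.I) * ((u ^ (2 - Δ) : ℝ) : ℂ) * e₁
      - (1 + (0 : ℝ) * Complex.I) * ((u ^ (2 : ℝ) : ℝ) : ℂ) * e₂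
      = (ζ * Complex.I) * ((u ^ (2 - Δ) : ℝ) : ℂ) * e₁
        + ((u ^ (2 - Δ) - u ^ (2 : ℝ) : ℝ) : ℂ) * e₁
        + ((u ^ (2 : ℝ) : ℝ) : ℂ) * (e₁ - e₂) := by
    push_cast; ring
  rw [hsplit]
  have h1 : ‖(ζ * Complex.I) * ((u ^ (2 - Δ) : ℝ) : ℂ) * e₁‖ ≤ 2 * Δ * u ^ (2 - Δ) := by
    rw [norm_mul, norm_mul, norm_mul, hn₁, Complex.norm_I, Complex.norm_real, Complex.norm_real,
      Real.norm_eq_abs, Real.norm_of_nonneg hA.le, mul_one, mul_one]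
    gcongr
  have h2 : ‖((u ^ (2 - Δ) - u ^ (2 : ℝ) : ℝ) : ℂ) * e₁‖
      ≤ Δ * (u + 2 * u ^ (-(1 / 2) : ℝ)) * (u ^ (2 - Δ) + u ^ (2 : ℝ)) := by
    rw [norm_mul, hn₁, mul_one, Complex.norm_real, Real.norm_eq_abs]
    refine hdiff.trans ?_
    gcongr
  have h3 : ‖((u ^ (2 : ℝ) : ℝ) : ℂ) * (e₁ - e₂)‖ ≤ Δ * u ^ (2 : ℝ) := by
    rw [norm_mul, Complex.norm_real, Real.norm_of_nonneg hB.le, mul_comm]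
    gcongr
  refine (norm_add₃_le).trans ((add_le_add (add_le_add h1 h2) h3).trans ?_)
  have : 0 ≤ Δ * u * (u ^ (2 - Δ) + u ^ (2 : ℝ)) := by positivity
  have : 0 ≤ Δ * u ^ (2 : ℝ) := by positivity
  nlinarith

theorem rpow_le_sq_add_pow_five {v e : ℝ} (hv : 0 < v) (h2 : 2 ≤ e) (h5 : e ≤ 5) :
    v ^ e ≤ v ^ (2 : ℝ) + v ^ (5 : ℝ) := by
  have p2 : 0 < v ^ (2 : ℝ) := by positivity
  have p5 : 0 < v ^ (5 : ℝ) := by positivity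
  rcases le_total v 1 with h | h
  · have := Real.rpow_le_rpow_of_exponent_ge hv h h2
    linarith
  · have := Real.rpow_le_rpow_of_exponent_le h h5
    linarith

theorem rpow_le_scaled {u y e m : ℝ} (hu : 0 < u) (hy : 1 ≤ y) (h2 : 2 ≤ e) (h5 : e ≤ 5)
    (hm : m ≤ e) : u ^ e ≤ y ^ (-m) * (y ^ (2 : ℝ) * u ^ (2 : ℝ) + y ^ (5 : ℝ) * u ^ (5 : ℝ)) := by
  have hy0 : 0 < y := by linarith
  have h := rpow_le_sq_add_pow_five (mul_pos hy0 hu) h2 h5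
  rw [Real.mul_rpow hy0.le hu.le, Real.mul_rpow hy0.le hu.le, Real.mul_rpow hy0.le hu.le] at h
  have h1 : u ^ e = y ^ (-e) * (y ^ e * u ^ e) := by
    rw [← mul_assoc, ← Real.rpow_add hy0, neg_add_cancel, Real.rpow_zero, one_mul]
  rw [h1]
  have h3 : y ^ (-e) ≤ y ^ (-m) := Real.rpow_le_rpow_of_exponent_le hy (by linarith)
  gcongr

theorem norm_exp_stable_exponent_sub_le {Δ ζ u y : ℝ} (hΔ : 0 < Δ) (hΔ' : Δ ≤ 1 / 8)
    (hζ : |ζ| ≤ 2 * Δ) (hu : 0 < u) (hy : 1 ≤ y) (w₁ w₂ : ℂ)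
    (hw₁ : w₁ = (1 + ζ * Complex.I) * ((u ^ (2 - Δ) : ℝ) : ℂ)
        * Complex.exp (-(Complex.I * ((2 - Δ : ℝ) : ℂ) * ((1 / 4 : ℝ) : ℂ))))
    (hw₂ : w₂ = (1 + (0 : ℝ) * Complex.I) * ((u ^ (2 : ℝ) : ℝ) : ℂ)
        * Complex.exp (-(Complex.I * ((2 : ℝ) : ℂ) * ((1 / 4 : ℝ) : ℂ)))) :
    ‖Complex.exp (-w₁) - Complex.exp (-w₂) - (w₂ - w₁)‖
      ≤ 48 * Δ * (y ^ (-(7 / 2 - 2 * Δ)) *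
        (y ^ (2 : ℝ) * u ^ (2 : ℝ) + y ^ (5 : ℝ) * u ^ (5 : ℝ))) := by
  have hA : 0 < u ^ (2 - Δ) := by positivity
  have hB : 0 < u ^ (2 : ℝ) := by positivity
  have hζ' : |ζ| ≤ 1 / 4 := by linarith
  have hre₁ : 0 ≤ w₁.re := by
    rw [hw₁, mul_assoc Complex.I, ← Complex.ofReal_mul, re_stable_exponent]
    have := quarter_le_cos_add_mul_sin hζ' (φ := (2 - Δ) * (1 / 4))
      (by rw [abs_of_nonneg (by linarith)]; linarith)
    exact mul_nonneg hA.le (by linarith)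
  have hre₂ : 0 ≤ w₂.re := by
    rw [hw₂, mul_assoc Complex.I, ← Complex.ofReal_mul, re_stable_exponent]
    have := quarter_le_cos_add_mul_sin (ζ := 0) (by norm_num) (φ := 2 * (1 / 4))
      (by norm_num [abs_of_pos])
    exact mul_nonneg hB.le (by linarith)
  have hn₁ : ‖w₁‖ ≤ 2 * u ^ (2 - Δ) := by
    rw [hw₁, mul_assoc Complex.I, ← Complex.ofReal_mul, norm_mul, norm_mul, norm_exp_neg_I_mul,
      Complex.norm_real, Real.norm_of_nonneg hA.le, mul_one]
    gcongr
    refine (norm_add_le _ _).trans ?_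
    rw [norm_one, norm_mul, Complex.norm_I, Complex.norm_real, Real.norm_eq_abs]
    linarith
  have hn₂ : ‖w₂‖ = u ^ (2 : ℝ) := by
    rw [hw₂, mul_assoc Complex.I, ← Complex.ofReal_mul, norm_mul, norm_mul, norm_exp_neg_I_mul,
      Complex.norm_real, Real.norm_of_nonneg hB.le]
    simp
  have hd := norm_stable_exponent_sub_le hΔ hζ hu
  rw [← hw₁, ← hw₂] at hd
  refine (norm_exp_neg_sub_exp_neg_add_sub_le hre₁ hre₂).trans ?_
  have hr : 0 < u ^ (-(1 / 2) : ℝ) := by positivity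
  have hstep : ‖w₁ - w₂‖ * (‖w₁‖ + ‖w₂‖)
      ≤ (2 * Δ * ((u ^ (2 - Δ) + u ^ (2 : ℝ)) * (1 + u + u ^ (-(1 / 2) : ℝ))))
        * (2 * (u ^ (2 - Δ) + u ^ (2 : ℝ))) := by
    refine mul_le_mul hd (by linarith) (by positivity) (by positivity)
  refine hstep.trans ?_
  have hsq : (u ^ (2 - Δ) + u ^ (2 : ℝ)) * (u ^ (2 - Δ) + u ^ (2 : ℝ))
      ≤ 2 * (u ^ (4 - 2 * Δ) + u ^ (4 : ℝ)) := by
    have e1 : u ^ (4 - 2 * Δ) = u ^ (2 - Δ) * u ^ (2 - Δ) := by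
      rw [← Real.rpow_add hu]; ring_nf
    have e2 : u ^ (4 : ℝ) = u ^ (2 : ℝ) * u ^ (2 : ℝ) := by
      rw [← Real.rpow_add hu]; norm_num
    rw [e1, e2]
    nlinarith [sq_nonneg (u ^ (2 - Δ) - u ^ (2 : ℝ))]
  -- The exponents of `u` occurring below lie between `7/2 - 2Δ` and `5`; the smallest one sets the
  -- gain in `y`.
  set X := y ^ (-(7 / 2 - 2 * Δ)) * (y ^ (2 : ℝ) * u ^ (2 : ℝ) + y ^ (5 : ℝ) * u ^ (5 : ℝ)) with hX
  have hterm : (u ^ (4 - 2 * Δ) + u ^ (4 : ℝ)) * (1 + u + u ^ (-(1 / 2) : ℝ)) ≤ 6 * X := by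
    have k1 : u ^ (4 - 2 * Δ) ≤ X := rpow_le_scaled hu hy (by linarith) (by linarith) (by linarith)
    have k2 : u ^ (4 : ℝ) ≤ X := rpow_le_scaled hu hy (by linarith) (by linarith) (by linarith)
    have k3 : u ^ (4 - 2 * Δ) * u ≤ X := by
      rw [← Real.rpow_add_one hu.ne']
      exact rpow_le_scaled hu hy (by linarith) (by linarith) (by linarith)
    have k4 : u ^ (4 : ℝ) * u ≤ X := by
      rw [← Real.rpow_add_one hu.ne']
      exact rpow_le_scaled hu hy (by linarith) (by linarith) (by linarith)
    have k5 : u ^ (4 - 2 * Δ) * u ^ (-(1 / 2) : ℝ) ≤ X := by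
      rw [← Real.rpow_add hu]
      exact rpow_le_scaled hu hy (by linarith) (by linarith) (by linarith)
    have k6 : u ^ (4 : ℝ) * u ^ (-(1 / 2) : ℝ) ≤ X := by
      rw [← Real.rpow_add hu]
      exact rpow_le_scaled hu hy (by linarith) (by linarith) (by linarith)
    linarith
  have hpos : 0 < 1 + u + u ^ (-(1 / 2) : ℝ) := by positivity
  have hfin := mul_le_mul_of_nonneg_right hsq hpos.le
  calc _ = 4 * Δ * ((u ^ (2 - Δ) + u ^ (2 : ℝ)) * (u ^ (2 - Δ) + u ^ (2 : ℝ))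
        * (1 + u + u ^ (-(1 / 2) : ℝ))) := by ring
    _ ≤ 4 * Δ * (12 * X) := mul_le_mul_of_nonneg_left (by linarith) (by positivity)
    _ = 48 * Δ * X := by ring

/-! ### Expansion about the Gaussian integral. -/

/-- `∫ t ^ p exp (-i y t) dt` over `t > 0`, in the Abel sense. -/
def fourierPow (p y : ℝ) : ℂ :=
  ((y ^ (-(p + 1)) * Real.Gamma (p + 1) : ℝ) : ℂ)
    * Complex.exp (-(Complex.I * ((p + 1 : ℝ) : ℂ) * ((Real.pi / 2 : ℝ) : ℂ)))

theorem rayIntegrand_eq_mul (p α : ℝ) (A c : ℂ) (θ u : ℝ) :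
    rayIntegrand p α A c θ u = rayIntegrand p 1 A 0 θ u
      * Complex.exp (-(c * ((u ^ α : ℝ) : ℂ) * Complex.exp (-(Complex.I * α * θ)))) := by
  unfold rayIntegrand
  rw [mul_assoc (((u ^ p : ℝ) : ℂ)), ← Complex.exp_add]
  congr 2
  ring

/-- Multiplication by `t^α` on the ray raises the exponent `p`, so the linear terms `w₂ - w₁`
integrate to values of `fourierPow`. -/
theorem rayIntegrand_add (p α : ℝ) (A : ℂ) (θ : ℝ) {u : ℝ} (hu : 0 < u) :
    rayIntegrand (p + α) 1 A 0 θ u = rayIntegrand p 1 A 0 θ u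
      * (((u ^ α : ℝ) : ℂ) * Complex.exp (-(Complex.I * α * θ))) := by
  unfold rayIntegrand
  rw [Real.rpow_add hu, mul_mul_mul_comm, ← Complex.exp_add, ← Complex.ofReal_mul]
  congr 2
  push_cast
  ring

theorem norm_rayIntegrand_one (p y θ : ℝ) {u : ℝ} (hu : 0 < u) :
    ‖rayIntegrand p 1 (Complex.I * y) 0 θ u‖ = u ^ p * Real.exp (-(y * Real.sin θ * u)) := by
  rw [norm_rayIntegrand _ _ _ _ _ hu, zero_mul, zero_mul, add_zero, re_I_mul_exp]
  congr 2
  ring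

theorem sin_quarter_pos : 0 < Real.sin (1 / 4) :=
  Real.sin_pos_of_pos_of_lt_pi (by norm_num) (by linarith [Real.pi_gt_three])

theorem integrableOn_rayIntegrand_one {p y : ℝ} (hp : -1 < p) (hy : 0 < y) :
    IntegrableOn (rayIntegrand p 1 (Complex.I * y) 0 (1 / 4)) (Set.Ioi 0) := by
  have := sin_quarter_pos
  refine integrableOn_rayIntegrand (q := 1) (κ := y * Real.sin (1 / 4)) (C := 0) hp one_pos
    (by positivity) fun u hu => ?_
  rw [zero_mul, zero_mul, add_zero, re_I_mul_exp, Real.rpow_one, sub_zero]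
  exact le_of_eq (by ring)

theorem integral_rayIntegrand_one {p y : ℝ} (hp : -1 < p) (hy : 0 < y) :
    ∫ u in Set.Ioi 0, rayIntegrand p 1 (Complex.I * y) 0 (1 / 4) u = fourierPow p y :=
  integral_rayIntegrand_gamma hp hy ⟨by norm_num, by linarith [Real.pi_gt_three]⟩

theorem integrableOn_rayIntegrand_stable {p ζ α : ℝ} (hp : -1 < p) (hα : 1 < α) (hα2 : α ≤ 2)
    (hζ : |ζ| ≤ 1 / 4) (y : ℝ) :
    IntegrableOn (rayIntegrand p α (Complex.I * y) (1 + ζ * Complex.I) (1 / 4)) (Set.Ioi 0) := by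
  obtain ⟨C, hC⟩ := exists_decay hα hα2 hζ y
  exact integrableOn_rayIntegrand hp (q := α) (κ := 1 / 8) (by linarith) (by norm_num)
    (hC (1 / 4) (by norm_num))

theorem integral_weight {p y s : ℝ} (hp : -1 < p) (hy : 0 < y) (hs : 0 < s) (n : ℝ) (hn : 0 ≤ n) :
    IntegrableOn (fun u : ℝ => y ^ n * (u ^ (p + n) * Real.exp (-(y * s * u)))) (Set.Ioi 0) ∧
    ∫ u in Set.Ioi 0, y ^ n * (u ^ (p + n) * Real.exp (-(y * s * u)))
      = y ^ (-(p + 1)) * ((1 / s) ^ (p + n + 1) * Real.Gamma (p + n + 1)) := by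
  have hys : 0 < y * s := by positivity
  constructor
  · have h := integrableOn_rpow_mul_exp_neg_mul_rpow (p := 1) (s := p + n) (b := y * s)
      (by linarith) one_pos hys
    refine (h.congr_fun (fun u _ => ?_) measurableSet_Ioi).const_mul _
    simp only [Real.rpow_one, neg_mul]
  · have h := Real.integral_rpow_mul_exp_neg_mul_Ioi (a := p + n + 1) (r := y * s) (by linarith) hys
    rw [integral_const_mul]
    rw [add_sub_cancel_right] at h
    rw [h, one_div, one_div, Real.inv_rpow hys.le, Real.mul_rpow hy.le hs.le, Real.inv_rpow hs.le,
      Real.rpow_neg hy.le, show p + n + 1 = p + 1 + n by ring, Real.rpow_add hy (p + 1)]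
    field_simp

/-- Uniform expansion of the one-sided Fourier integral of the stable characteristic function about
the Gaussian one. -/
theorem exists_halfFourier_expansion {p : ℝ} (hp : -1 < p) :
    ∃ C : ℝ, 0 < C ∧ ∀ Δ ζ y : ℝ, 0 < Δ → Δ ≤ 1 / 8 → |ζ| ≤ 2 * Δ → 1 ≤ y →
      ‖halfFourier p ζ (2 - Δ) y - halfFourier p 0 2 y
          - (fourierPow (p + 2) y - (1 + ζ * Complex.I) * fourierPow (p + (2 - Δ)) y)‖
        ≤ C * Δ * y ^ (Δ - 4 - p) := by
  have hs := sin_quarter_pos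
  set s := Real.sin (1 / 4) with hs_def
  set K : ℝ := (1 / s) ^ (p + 2 + 1) * Real.Gamma (p + 2 + 1)
    + (1 / s) ^ (p + 5 + 1) * Real.Gamma (p + 5 + 1) with hK
  have hKpos : 0 < K := by
    have := Real.Gamma_pos_of_pos (s := p + 2 + 1) (by linarith)
    have := Real.Gamma_pos_of_pos (s := p + 5 + 1) (by linarith)
    positivity
  refine ⟨48 * K, by positivity, fun Δ ζ y hΔ hΔ' hζ hy => ?_⟩
  have hy0 : 0 < y := by linarith
  have hζ' : |ζ| ≤ 1 / 4 := by linarith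
  have i₁ := integrableOn_rayIntegrand_stable (p := p) (α := 2 - Δ) hp (by linarith) (by linarith) hζ' y
  have i₂ := integrableOn_rayIntegrand_stable (p := p) (α := 2) (ζ := 0) hp (by linarith) le_rfl
    (by norm_num) y
  have i₃ := integrableOn_rayIntegrand_one (p := p + 2) (by linarith) hy0
  have i₄ := integrableOn_rayIntegrand_one (p := p + (2 - Δ)) (by linarith) hy0
  have i₁₂ : IntegrableOn (fun u => rayIntegrand p (2 - Δ) (Complex.I * y) (1 + ζ * Complex.I) (1 / 4) u
      - rayIntegrand p 2 (Complex.I * y) (1 + (0 : ℝ) * Complex.I) (1 / 4) u) (Set.Ioi 0) := i₁.sub i₂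
  have i₃₄ : IntegrableOn (fun u => rayIntegrand (p + 2) 1 (Complex.I * y) 0 (1 / 4) u
      - (1 + ζ * Complex.I) * rayIntegrand (p + (2 - Δ)) 1 (Complex.I * y) 0 (1 / 4) u)
      (Set.Ioi 0) := i₃.sub (i₄.const_mul _)
  rw [halfFourier_eq_ray (α := 2 - Δ) hp (by linarith) (by linarith) hζ',
    halfFourier_eq_ray (α := 2) hp (by linarith) le_rfl (by norm_num),
    ← integral_rayIntegrand_one (p := p + 2) (by linarith) hy0,
    ← integral_rayIntegrand_one (p := p + (2 - Δ)) (by linarith) hy0,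
    ← integral_const_mul, ← integral_sub i₁ i₂, ← integral_sub i₃ (i₄.const_mul _),
    ← integral_sub i₁₂ i₃₄]
  obtain ⟨j₂, e₂⟩ := integral_weight (p := p) hp hy0 hs 2 (by norm_num)
  obtain ⟨j₅, e₅⟩ := integral_weight (p := p) hp hy0 hs 5 (by norm_num)
  refine (norm_integral_le_of_norm_le (((j₂.add j₅).const_mul
    (48 * Δ * y ^ (-(7 / 2 - 2 * Δ))))) ?_).trans ?_
  · filter_upwards [ae_restrict_mem measurableSet_Ioi] with u hu
    have hu : 0 < u := hu
    rw [rayIntegrand_eq_mul p (2 - Δ), rayIntegrand_eq_mul p 2, rayIntegrand_add p 2 _ _ hu,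
      rayIntegrand_add p (2 - Δ) _ _ hu]
    set w₁ := (1 + ζ * Complex.I) * ((u ^ (2 - Δ) : ℝ) : ℂ)
        * Complex.exp (-(Complex.I * ((2 - Δ : ℝ) : ℂ) * ((1 / 4 : ℝ) : ℂ))) with hw₁
    set w₂ := (1 + (0 : ℝ) * Complex.I) * ((u ^ (2 : ℝ) : ℝ) : ℂ)
        * Complex.exp (-(Complex.I * ((2 : ℝ) : ℂ) * ((1 / 4 : ℝ) : ℂ))) with hw₂
    have hb := norm_exp_stable_exponent_sub_le hΔ hΔ' hζ hu hy w₁ w₂ hw₁ hw₂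
    have hw₂' : ((u ^ (2 : ℝ) : ℝ) : ℂ)
        * Complex.exp (-(Complex.I * ((2 : ℝ) : ℂ) * ((1 / 4 : ℝ) : ℂ))) = w₂ := by
      rw [hw₂]; push_cast; ring
    rw [hw₂', show ∀ b : ℂ, b * Complex.exp (-w₁) - b * Complex.exp (-w₂)
        - (b * w₂ - (1 + ζ * Complex.I) * (b * (((u ^ (2 - Δ) : ℝ) : ℂ)
        * Complex.exp (-(Complex.I * ((2 - Δ : ℝ) : ℂ) * ((1 / 4 : ℝ) : ℂ))))))
        = b * (Complex.exp (-w₁) - Complex.exp (-w₂) - (w₂ - w₁)) by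
          intro b; rw [hw₁]; ring, norm_mul, norm_rayIntegrand_one _ _ _ hu]
    refine (mul_le_mul_of_nonneg_left hb (by positivity)).trans (le_of_eq ?_)
    simp only [Pi.add_apply]
    rw [Real.rpow_add hu, Real.rpow_add hu]
    ring
  · have hsum : ∫ u in Set.Ioi 0, ((fun u : ℝ => y ^ (2 : ℝ) * (u ^ (p + 2) * Real.exp (-(y * s * u))))
        + fun u : ℝ => y ^ (5 : ℝ) * (u ^ (p + 5) * Real.exp (-(y * s * u)))) u
        = y ^ (-(p + 1)) * K := by
      rw [integral_add' j₂ j₅, e₂, e₅, hK]; ring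
    rw [integral_const_mul, hsum]
    -- The exponent obtained is `2Δ - 9/2 - p`, which is at most `Δ - 4 - p` as soon as `Δ ≤ 1/2`.
    have hexp : y ^ (-(7 / 2 - 2 * Δ)) * y ^ (-(p + 1)) ≤ y ^ (Δ - 4 - p) := by
      rw [← Real.rpow_add hy0]
      exact Real.rpow_le_rpow_of_exponent_le hy (by linarith)
    calc _ = 48 * K * Δ * (y ^ (-(7 / 2 - 2 * Δ)) * y ^ (-(p + 1))) := by ring
      _ ≤ _ := by gcongr

theorem fourierPow_eq {p : ℝ} (n : ℕ) (Δ y : ℝ) (hn : p = n + 2 - Δ) :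
    fourierPow p y = ((y ^ (Δ - 3 - n) * Real.Gamma (n + 3 - Δ) : ℝ) : ℂ) * ((-Complex.I) ^ (n + 3)
      * (Real.cos (Real.pi * Δ / 2) + Real.sin (Real.pi * Δ / 2) * Complex.I)) := by
  unfold fourierPow
  rw [hn, show -((n : ℝ) + 2 - Δ + 1) = Δ - 3 - n by ring,
    show (n : ℝ) + 2 - Δ + 1 = n + 3 - Δ by ring,
    show -(Complex.I * ((n + 3 - Δ : ℝ) : ℂ) * ((Real.pi / 2 : ℝ) : ℂ))
      = (n + 3 : ℕ) * (-(Real.pi / 2 * Complex.I)) + ((Real.pi * Δ / 2 : ℝ) : ℂ) * Complex.I by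
        push_cast; ring, Complex.exp_add, Complex.exp_nat_mul, Complex.exp_neg,
    Complex.exp_pi_div_two_mul_I, Complex.inv_I, Complex.exp_mul_I, Complex.ofReal_cos,
    Complex.ofReal_sin]

/-! ### Tail expansions of the standardised density and its derivative. -/

/-- The density of the standardised stable law. -/
def stdDensity (ζ α y : ℝ) : ℝ := Real.pi⁻¹ * (halfFourier 0 ζ α y).re

/-- The derivative of `stdDensity` in `y`. -/
def stdDensityDeriv (ζ α y : ℝ) : ℝ := Real.pi⁻¹ * (-Complex.I * halfFourier 1 ζ α y).re

theorem cos_half_pi_mul_pos {Δ : ℝ} (hΔ : 0 < Δ) (hΔ' : Δ ≤ 1 / 8) :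
    0.97 < Real.cos (Real.pi * Δ / 2) := by
  have h := Real.one_sub_sq_div_two_le_cos (x := Real.pi * Δ / 2)
  have h1 : Real.pi * Δ / 2 ≤ 1 / 4 * (4 / 5) := by nlinarith [Real.pi_lt_d2, Real.pi_pos]
  have h2 : 0 < Real.pi * Δ / 2 := by have := Real.pi_pos; positivity
  nlinarith

theorem abs_mul_tan_le {Δ β : ℝ} (hΔ : 0 < Δ) (hΔ' : Δ ≤ 1 / 8) (hβ : |β| ≤ 1) :
    |β * Real.tan (Real.pi * Δ / 2)| ≤ 2 * Δ := by
  have hc := cos_half_pi_mul_pos hΔ hΔ'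
  have h2 : 0 < Real.pi * Δ / 2 := by have := Real.pi_pos; positivity
  have hs := Real.sin_lt h2
  have hs0 : 0 ≤ Real.sin (Real.pi * Δ / 2) :=
    Real.sin_nonneg_of_nonneg_of_le_pi h2.le (by nlinarith [Real.pi_pos])
  have ht0 : 0 ≤ Real.tan (Real.pi * Δ / 2) := by
    rw [Real.tan_eq_sin_div_cos]; exact div_nonneg hs0 (by linarith)
  have ht : Real.tan (Real.pi * Δ / 2) ≤ 2 * Δ := by
    rw [Real.tan_eq_sin_div_cos, div_le_iff₀ (by linarith)]
    nlinarith [Real.pi_lt_d2]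
  rw [abs_mul, abs_of_nonneg ht0]
  nlinarith [abs_nonneg β]

theorem exists_stdDensity_expansion : ∃ C : ℝ, 0 < C ∧ ∀ Δ β y : ℝ, 0 < Δ → Δ ≤ 1 / 8 → |β| ≤ 1 →
    1 ≤ y →
    |stdDensity (β * Real.tan (Real.pi * Δ / 2)) (2 - Δ) y - stdDensity 0 2 y
        - (1 + β) * (Real.pi⁻¹ * Real.sin (Real.pi * Δ / 2) * Real.Gamma (3 - Δ)) * y ^ (Δ - 3)|
      ≤ C * Δ * y ^ (Δ - 4) := by
  obtain ⟨C, hC, h⟩ := exists_halfFourier_expansion (p := 0) (by norm_num)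
  refine ⟨C, hC, fun Δ β y hΔ hΔ' hβ hy => ?_⟩
  have hc := cos_half_pi_mul_pos hΔ hΔ'
  have h0 := h Δ _ y hΔ hΔ' (abs_mul_tan_le hΔ hΔ' hβ) hy
  rw [fourierPow_eq 0 0 y (by norm_num), fourierPow_eq 0 Δ y (by norm_num)] at h0
  have h1 := (Complex.abs_re_le_norm _).trans h0
  refine le_trans ?_ (h1.trans (le_of_eq (by rw [sub_zero])))
  set T := Real.tan (Real.pi * Δ / 2) with hT
  have hTc : T * Real.cos (Real.pi * Δ / 2) = Real.sin (Real.pi * Δ / 2) :=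
    Real.tan_mul_cos (by linarith)
  have hI : (-Complex.I) ^ (0 + 3) = Complex.I := by
    rw [zero_add, neg_pow, Complex.I_pow_three]; norm_num
  rw [hI]
  unfold stdDensity
  have hmain : ((((y ^ (0 - 3 - ((0 : ℕ) : ℝ)) * Real.Gamma (((0 : ℕ) : ℝ) + 3 - 0) : ℝ) : ℂ)
      * (Complex.I * (Real.cos (Real.pi * 0 / 2) + Real.sin (Real.pi * 0 / 2) * Complex.I)))
      -- The Gaussian term `fourierPow 2 y` is purely imaginary and drops out. In the stable term
      -- the real part produces `sin + β T cos`, and `T cos = sin` makes this `(1 + β) sin`.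
      - (1 + ((β * T : ℝ) : ℂ) * Complex.I) * (((y ^ (Δ - 3 - ((0 : ℕ) : ℝ))
        * Real.Gamma (((0 : ℕ) : ℝ) + 3 - Δ) : ℝ) : ℂ)
      * (Complex.I * (Real.cos (Real.pi * Δ / 2) + Real.sin (Real.pi * Δ / 2) * Complex.I)))).re
      = (1 + β) * (Real.sin (Real.pi * Δ / 2) * Real.Gamma (3 - Δ)) * y ^ (Δ - 3) := by
    simp only [mul_zero, zero_div, Real.sin_zero, Real.cos_zero, Nat.cast_zero, sub_zero, zero_add,
      Complex.sub_re, Complex.add_re, Complex.mul_re, Complex.add_im, Complex.mul_im,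
      Complex.ofReal_re, Complex.ofReal_im, Complex.I_re, Complex.I_im, Complex.one_re,
      Complex.one_im]
    linear_combination (β * y ^ (Δ - 3) * Real.Gamma (3 - Δ)) * hTc
  rw [Complex.sub_re, Complex.sub_re, hmain]
  refine le_trans (le_of_eq ?_) (mul_le_of_le_one_left (abs_nonneg _)
    (inv_le_one_of_one_le₀ (by linarith [Real.pi_gt_three] : (1 : ℝ) ≤ Real.pi)))
  rw [← abs_of_pos (inv_pos.2 Real.pi_pos), ← abs_mul, abs_of_pos (inv_pos.2 Real.pi_pos)]
  congr 1
  ring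

theorem exists_stdDensityDeriv_expansion : ∃ C : ℝ, 0 < C ∧ ∀ Δ β y : ℝ, 0 < Δ → Δ ≤ 1 / 8 →
    |β| ≤ 1 → 1 ≤ y →
    |stdDensityDeriv (β * Real.tan (Real.pi * Δ / 2)) (2 - Δ) y - stdDensityDeriv 0 2 y
        + (1 + β) * (Real.pi⁻¹ * Real.sin (Real.pi * Δ / 2) * Real.Gamma (4 - Δ)) * y ^ (Δ - 4)|
      ≤ C * Δ * y ^ (Δ - 5) := by
  obtain ⟨C, hC, h⟩ := exists_halfFourier_expansion (p := 1) (by norm_num)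
  refine ⟨C, hC, fun Δ β y hΔ hΔ' hβ hy => ?_⟩
  have hc := cos_half_pi_mul_pos hΔ hΔ'
  have h0 := h Δ _ y hΔ hΔ' (abs_mul_tan_le hΔ hΔ' hβ) hy
  rw [fourierPow_eq 1 0 y (by norm_num), fourierPow_eq 1 Δ y (by push_cast; ring)] at h0
  have h1 := (Complex.abs_im_le_norm _).trans h0
  refine le_trans ?_ (h1.trans (le_of_eq (by rw [show Δ - 4 - 1 = Δ - 5 by ring])))
  set T := Real.tan (Real.pi * Δ / 2) with hT
  have hTc : T * Real.cos (Real.pi * Δ / 2) = Real.sin (Real.pi * Δ / 2) :=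
    Real.tan_mul_cos (by linarith)
  have hI : (-Complex.I) ^ (1 + 3) = 1 := by
    rw [neg_pow, Complex.I_pow_four]; norm_num
  rw [hI]
  unfold stdDensityDeriv
  have hmain : ((((y ^ (0 - 3 - ((1 : ℕ) : ℝ)) * Real.Gamma (((1 : ℕ) : ℝ) + 3 - 0) : ℝ) : ℂ)
      * (1 * (Real.cos (Real.pi * 0 / 2) + Real.sin (Real.pi * 0 / 2) * Complex.I)))
      - (1 + ((β * T : ℝ) : ℂ) * Complex.I) * (((y ^ (Δ - 3 - ((1 : ℕ) : ℝ))
        * Real.Gamma (((1 : ℕ) : ℝ) + 3 - Δ) : ℝ) : ℂ)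
      * (1 * (Real.cos (Real.pi * Δ / 2) + Real.sin (Real.pi * Δ / 2) * Complex.I)))).im
      = -((1 + β) * (Real.sin (Real.pi * Δ / 2) * Real.Gamma (4 - Δ)) * y ^ (Δ - 4)) := by
    rw [show Δ - 3 - ((1 : ℕ) : ℝ) = Δ - 4 by push_cast; ring,
      show ((1 : ℕ) : ℝ) + 3 - Δ = 4 - Δ by push_cast; ring]
    simp only [mul_zero, zero_div, Real.sin_zero, Real.cos_zero,
      Complex.sub_im, Complex.add_re, Complex.mul_re, Complex.add_im, Complex.mul_im,
      Complex.ofReal_re, Complex.ofReal_im, Complex.I_re, Complex.I_im, Complex.one_re,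
      Complex.one_im]
    linear_combination (-(β * y ^ (Δ - 4) * Real.Gamma (4 - Δ))) * hTc
  rw [Complex.sub_im, Complex.sub_im, hmain]
  refine le_trans (le_of_eq ?_) (mul_le_of_le_one_left (abs_nonneg _)
    (inv_le_one_of_one_le₀ (by linarith [Real.pi_gt_three] : (1 : ℝ) ≤ Real.pi)))
  rw [← abs_of_pos (inv_pos.2 Real.pi_pos), ← abs_mul, abs_of_pos (inv_pos.2 Real.pi_pos)]
  congr 1
  have hre : ∀ z : ℂ, (-Complex.I * z).re = z.im := fun z => by simp [Complex.mul_re]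
  rw [hre, hre]
  ring

/-! ### Reduction of the density and its scale derivative to the standardised form. -/

theorem continuousOn_halfFourier_integrand (p ζ α y : ℝ) :
    ContinuousOn (fun u : ℝ => ((u ^ p : ℝ) : ℂ) * Complex.exp (-(Complex.I * y * u)
      - (1 + ζ * Complex.I) * ((u ^ α : ℝ) : ℂ))) (Set.Ioi 0) := by
  have h := continuousOn_rayIntegrand p α (Complex.I * y) (1 + ζ * Complex.I) 0
  exact h.congr fun u _ => by simp [rayIntegrand]

theorem norm_halfFourier_integrand (p ζ α y : ℝ) {u : ℝ} (hu : 0 < u) :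
    ‖((u ^ p : ℝ) : ℂ) * Complex.exp (-(Complex.I * y * u)
      - (1 + ζ * Complex.I) * ((u ^ α : ℝ) : ℂ))‖ = u ^ p * Real.exp (-1 * u ^ α) := by
  rw [norm_mul, Complex.norm_exp, Complex.norm_real, Real.norm_of_nonneg (by positivity)]
  congr 2
  simp [Complex.mul_re, Complex.mul_im]

theorem integrableOn_halfFourier_integrand {p α : ℝ} (hp : -1 < p) (hα : 0 < α) (ζ y : ℝ) :
    IntegrableOn (fun u : ℝ => ((u ^ p : ℝ) : ℂ) * Complex.exp (-(Complex.I * y * u)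
      - (1 + ζ * Complex.I) * ((u ^ α : ℝ) : ℂ))) (Set.Ioi 0) := by
  refine Integrable.mono' (integrableOn_rpow_mul_exp_neg_mul_rpow hp hα one_pos)
    ((continuousOn_halfFourier_integrand p ζ α y).aestronglyMeasurable measurableSet_Ioi) ?_
  filter_upwards [ae_restrict_mem measurableSet_Ioi] with u hu
  exact (norm_halfFourier_integrand p ζ α y hu).le

theorem hasDerivAt_halfFourier {p α : ℝ} (hp : -1 < p) (hα : 0 < α) (ζ y : ℝ) :
    HasDerivAt (halfFourier p ζ α) (-Complex.I * halfFourier (p + 1) ζ α y) y := by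
  have h := (hasDerivAt_integral_of_dominated_loc_of_deriv_le (μ := volume.restrict (Set.Ioi 0))
    (F := fun (y u : ℝ) => ((u ^ p : ℝ) : ℂ) * Complex.exp (-(Complex.I * y * u)
      - (1 + ζ * Complex.I) * ((u ^ α : ℝ) : ℂ))) (x₀ := y) (s := Set.univ)
    (bound := fun u => u ^ (p + 1) * Real.exp (-1 * u ^ α))
    (F' := fun (y u : ℝ) => -Complex.I * (((u ^ (p + 1) : ℝ) : ℂ) * Complex.exp (-(Complex.I * y * u)
      - (1 + ζ * Complex.I) * ((u ^ α : ℝ) : ℂ))))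
    Filter.univ_mem
    (Filter.Eventually.of_forall fun y =>
      (continuousOn_halfFourier_integrand p ζ α y).aestronglyMeasurable measurableSet_Ioi)
    (integrableOn_halfFourier_integrand hp hα ζ y)
    (((continuousOn_halfFourier_integrand (p + 1) ζ α y).aestronglyMeasurable
      measurableSet_Ioi).const_mul _)
    (by
      filter_upwards [ae_restrict_mem measurableSet_Ioi] with u hu y _
      rw [norm_mul, norm_neg, Complex.norm_I, one_mul]
      exact (norm_halfFourier_integrand (p + 1) ζ α y hu).le)
    (integrableOn_rpow_mul_exp_neg_mul_rpow (by linarith) hα one_pos)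
    (by
      filter_upwards [ae_restrict_mem measurableSet_Ioi] with u hu y _
      have hu : 0 < u := hu
      have hid : HasDerivAt (fun y : ℝ => (y : ℂ)) 1 y := Complex.ofRealCLM.hasDerivAt
      have h1 : HasDerivAt (fun y : ℝ => -(Complex.I * y * u)
          - (1 + ζ * Complex.I) * ((u ^ α : ℝ) : ℂ)) (-(Complex.I * 1 * u)) y :=
        ((hid.const_mul Complex.I).mul_const _).neg.sub_const _
      refine (h1.cexp.const_mul _).congr_deriv ?_
      rw [Real.rpow_add_one hu.ne']
      push_cast
      ring)).2
  refine h.congr_deriv ?_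
  rw [integral_const_mul]
  rfl

theorem hasDerivAt_stdDensity {α : ℝ} (hα : 0 < α) (ζ y : ℝ) :
    HasDerivAt (stdDensity ζ α) (stdDensityDeriv ζ α y) y := by
  have h := hasDerivAt_halfFourier (p := 0) (by norm_num) hα ζ y
  rw [zero_add] at h
  have h2 := (Complex.reCLM.hasFDerivAt.comp_hasDerivAt y h).const_mul Real.pi⁻¹
  exact h2

/-- Conjugating the integrand changes the signs of both `y` and `ζ`; negative arguments therefore
reduce to positive ones with `β` reversed. -/
theorem halfFourier_neg (p ζ α y : ℝ) :
    halfFourier p ζ α (-y) = (starRingEnd ℂ) (halfFourier p (-ζ) α y) := by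
  unfold halfFourier
  rw [← integral_conj]
  refine integral_congr_ae (Filter.Eventually.of_forall fun u => ?_)
  simp only [map_mul, Complex.conj_ofReal, ← Complex.exp_conj, map_sub, map_neg, map_add, map_one,
    Complex.conj_I]
  congr 2
  push_cast
  ring

theorem stdDensity_neg (ζ α y : ℝ) : stdDensity ζ α (-y) = stdDensity (-ζ) α y := by
  rw [stdDensity, halfFourier_neg, Complex.conj_re, stdDensity]

theorem stdDensityDeriv_neg (ζ α y : ℝ) : stdDensityDeriv ζ α (-y) = -stdDensityDeriv (-ζ) α y := by
  rw [stdDensityDeriv, halfFourier_neg, stdDensityDeriv]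
  simp [Complex.mul_re]

/-- With `u = σt`, the term `u^α β tan(πα/2)(u^(1-α) - 1)` splits into `-ζu + ζu^α`. The linear part
shifts the argument by `ζ` and the rest gives the factor `1 + iζ`. -/
theorem fourier_charFn_integrand {σ α β x t : ℝ} (hσ : 0 < σ) (ht : 0 < t) :
    Complex.exp (-(Complex.I * ((t * x : ℝ) : ℂ))) * charFn 0 σ α β t
      = (((σ * t) ^ (0 : ℝ) : ℝ) : ℂ) * Complex.exp (-(Complex.I * ((x / σ - zeta α β : ℝ) : ℂ)
        * ((σ * t : ℝ) : ℂ)) - (1 + zeta α β * Complex.I) * (((σ * t) ^ α : ℝ) : ℂ)) := by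
  have hst : 0 < σ * t := by positivity
  have hpow : (((σ * t) ^ α : ℝ) : ℂ) * (((σ * t) ^ (1 - α) : ℝ) : ℂ) = σ * t := by
    rw [← Complex.ofReal_mul, ← Real.rpow_add hst]
    simp
  unfold charFn
  rw [← Complex.exp_add, Real.rpow_zero, Complex.ofReal_one, one_mul, abs_of_pos hst,
    Real.sign_of_pos ht]
  congr 1
  have hσ' : (σ : ℂ) ≠ 0 := Complex.ofReal_ne_zero.2 hσ.ne'
  simp only [zeta]
  rw [Complex.ofReal_mul (β * 1 * _), Complex.ofReal_sub (_ ^ (1 - α)), Complex.ofReal_sub (x / σ)]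
  push_cast at hpow ⊢
  have hx : (x : ℂ) / σ * (σ * t) = t * x := by field_simp
  linear_combination (-Complex.I * β * Complex.tan (Real.pi * α / 2)) * hpow + Complex.I * hx

theorem fourier_charFn_integrand_neg (σ α β x t : ℝ) :
    Complex.exp (-(Complex.I * ((-t * x : ℝ) : ℂ))) * charFn 0 σ α β (-t)
      = (starRingEnd ℂ) (Complex.exp (-(Complex.I * ((t * x : ℝ) : ℂ))) * charFn 0 σ α β t) := by
  unfold charFn
  rw [map_mul, ← Complex.exp_conj, ← Complex.exp_conj, mul_neg, abs_neg, Real.sign_neg]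
  congr 2
  · simp
  · simp only [map_add, map_mul, map_neg, map_one, Complex.conj_ofReal, Complex.conj_I]
    push_cast
    ring

theorem density_eq_stdDensity {σ α : ℝ} (hσ : 0 < σ) (hα : 0 < α) (β x : ℝ) :
    density 0 σ α β x = σ⁻¹ * stdDensity (zeta α β) α (x / σ - zeta α β) := by
  set ζ := zeta α β with hζ
  set f : ℝ → ℂ := fun t => Complex.exp (-(Complex.I * ((t * x : ℝ) : ℂ))) * charFn 0 σ α β t with hf
  set G : ℝ → ℂ := fun u => ((u ^ (0 : ℝ) : ℝ) : ℂ) * Complex.exp (-(Complex.I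
    * ((x / σ - ζ : ℝ) : ℂ) * u) - (1 + ζ * Complex.I) * ((u ^ α : ℝ) : ℂ)) with hG
  have hfG : ∀ t ∈ Set.Ioi (0 : ℝ), f t = G (σ * t) := fun t ht => fourier_charFn_integrand hσ ht
  have hfneg : ∀ t : ℝ, f (-t) = (starRingEnd ℂ) (f t) := fourier_charFn_integrand_neg σ α β x
  have hGint : IntegrableOn G (Set.Ioi 0) :=
    integrableOn_halfFourier_integrand (by norm_num) hα ζ (x / σ - ζ)
  have hfint : IntegrableOn f (Set.Ioi 0) := by
    have h := (integrableOn_Ioi_comp_mul_left_iff G 0 hσ).2 (by simpa using hGint)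
    exact h.congr_fun (fun t ht => (hfG t ht).symm) measurableSet_Ioi
  have hfint' : IntegrableOn f (Set.Iic 0) := by
    have h : IntegrableOn (fun t => f (-t)) (Set.Ioi 0) := by
      simp_rw [hfneg]
      exact Complex.conjCLE.toContinuousLinearMap.integrable_comp hfint
    rw [integrableOn_Iic_iff_integrableOn_Iio]
    have h2 : IntegrableOn (fun t => f (-t)) (Set.Ioi (-0)) := by simpa using h
    simpa using h2.comp_neg_Iio
  have hI : ∫ t in Set.Ioi 0, f t = (σ⁻¹ : ℝ) • halfFourier 0 ζ α (x / σ - ζ) := by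
    rw [setIntegral_congr_fun measurableSet_Ioi hfG, integral_comp_mul_left_Ioi G 0 hσ, mul_zero]
    rfl
  have htot : ∫ t, f t = (starRingEnd ℂ) (∫ t in Set.Ioi 0, f t) + ∫ t in Set.Ioi 0, f t := by
    rw [← intervalIntegral.integral_Iic_add_Ioi hfint' hfint, ← integral_conj]
    congr 1
    simp_rw [← hfneg]
    rw [integral_comp_neg_Ioi, neg_zero]
  unfold density stdDensity
  change 1 / (2 * Real.pi) * (∫ t, f t).re = _
  rw [htot, Complex.add_re, Complex.conj_re, hI, Complex.smul_re, smul_eq_mul]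
  field_simp
  ring

/-- The chain rule at `σ = 1` brings out the factor `x`, not `y = x - ζ`, since the shift does not
scale; the discrepancy `ζ h'` has to be estimated later. -/
theorem densityScale_eq {α : ℝ} (hα : 0 < α) (β x : ℝ) :
    densityScale α β x = -stdDensity (zeta α β) α (x - zeta α β)
      - x * stdDensityDeriv (zeta α β) α (x - zeta α β) := by
  unfold densityScale
  have hev : (fun σ : ℝ => density 0 σ α β x) =ᶠ[nhds 1]
      fun σ => σ⁻¹ * stdDensity (zeta α β) α (x / σ - zeta α β) := by
    filter_upwards [lt_mem_nhds (one_pos : (0 : ℝ) < 1)] with σ hσ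
    exact density_eq_stdDensity hσ hα β x
  rw [hev.deriv_eq]
  have h1 : HasDerivAt (fun σ : ℝ => x / σ - zeta α β) (-x) 1 := by
    have := ((hasDerivAt_inv (one_ne_zero : (1 : ℝ) ≠ 0)).const_mul x).sub_const (zeta α β)
    simpa [div_eq_mul_inv] using! this
  have h2 : HasDerivAt (stdDensity (zeta α β) α)
      (stdDensityDeriv (zeta α β) α (x - zeta α β)) (x / 1 - zeta α β) := by
    rw [div_one]; exact hasDerivAt_stdDensity hα _ _
  have h3 := (hasDerivAt_inv (one_ne_zero : (1 : ℝ) ≠ 0)).mul (HasDerivAt.comp (1 : ℝ) h2 h1)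
  have h4 : HasDerivAt (fun σ : ℝ => σ⁻¹ * stdDensity (zeta α β) α (x / σ - zeta α β))
      (-stdDensity (zeta α β) α (x - zeta α β)
      - x * stdDensityDeriv (zeta α β) α (x - zeta α β)) 1 := by
    refine HasDerivAt.congr_deriv (f := fun σ : ℝ => σ⁻¹ * stdDensity (zeta α β) α (x / σ - zeta α β)) h3 ?_
    simp only [Function.comp, div_one, inv_one, one_pow]
    ring
  exact h4.deriv

/-! ### The Gaussian case, the two-sided expansion and the tail constants. -/

theorem gaussianPDFReal_two (y : ℝ) : ProbabilityTheory.gaussianPDFReal 0 2 y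
    = (2 * √Real.pi)⁻¹ * Real.exp (-y ^ 2 / 4) := by
  have h3 : √(2 * Real.pi * ((2 : NNReal) : ℝ)) = 2 * √Real.pi := by
    rw [show 2 * Real.pi * ((2 : NNReal) : ℝ) = 2 ^ 2 * Real.pi by push_cast; ring,
      Real.sqrt_mul (by norm_num), Real.sqrt_sq (by norm_num)]
  rw [ProbabilityTheory.gaussianPDFReal, h3, sub_zero,
    show -y ^ 2 / (2 * ((2 : NNReal) : ℝ)) = -y ^ 2 / 4 by push_cast; ring]

theorem stdDensity_gaussian (y : ℝ) :
    stdDensity 0 2 y = ProbabilityTheory.gaussianPDFReal 0 2 y := by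
  have h := density_eq_stdDensity (σ := 1) (α := 2) one_pos two_pos 0 y
  have hz : zeta 2 0 = 0 := by simp [zeta]
  rw [hz, inv_one, one_mul, div_one, sub_zero] at h
  rw [← h]
  unfold density
  have hF := fourierIntegral_gaussian (b := 1) (by simp) (-y)
  have hcongr : ∫ t : ℝ, Complex.exp (-(Complex.I * ((t * y : ℝ) : ℂ))) * charFn 0 1 2 0 t
      = ∫ t : ℝ, Complex.exp (Complex.I * -y * t) * Complex.exp (-1 * (t : ℂ) ^ 2) := by
    refine integral_congr_ae (Filter.Eventually.of_forall fun t => ?_)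
    simp only [charFn]
    congr 2
    · push_cast; ring
    · simp
  rw [hcongr, hF]
  have h1 : ((Real.pi : ℂ) / 1) ^ (1 / 2 : ℂ) = ((√Real.pi : ℝ) : ℂ) := by
    rw [div_one, Real.sqrt_eq_rpow, Complex.ofReal_cpow Real.pi_pos.le]
    norm_num
  have h2 : Complex.exp (-(-(y : ℂ)) ^ 2 / (4 * 1)) = ((Real.exp (-y ^ 2 / 4) : ℝ) : ℂ) := by
    push_cast; congr 1; ring
  rw [h1, h2, ← Complex.ofReal_mul, Complex.ofReal_re, gaussianPDFReal_two]
  have h4 := Real.mul_self_sqrt Real.pi_pos.le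
  have h5 : √Real.pi ≠ 0 := (Real.sqrt_pos.2 Real.pi_pos).ne'
  field_simp
  rw [sq, h4]

theorem stdDensityDeriv_gaussian (y : ℝ) :
    stdDensityDeriv 0 2 y = -(y / 2) * ProbabilityTheory.gaussianPDFReal 0 2 y := by
  have h1 := hasDerivAt_stdDensity (α := 2) two_pos 0 y
  have h2 : HasDerivAt (stdDensity 0 2) (-(y / 2) * ProbabilityTheory.gaussianPDFReal 0 2 y) y := by
    rw [show stdDensity 0 2 = fun y => (2 * √Real.pi)⁻¹ * Real.exp (-y ^ 2 / 4) from
      funext fun y => (stdDensity_gaussian y).trans (gaussianPDFReal_two y), gaussianPDFReal_two]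
    have h := ((((hasDerivAt_pow 2 y).neg).div_const 4).exp).const_mul (2 * √Real.pi)⁻¹
    refine HasDerivAt.congr_deriv (f := fun y : ℝ => (2 * √Real.pi)⁻¹ * Real.exp (-y ^ 2 / 4)) h ?_
    simp only [Pi.neg_apply]
    push_cast
    ring
  exact h1.unique h2

theorem zeta_two_sub (Δ β : ℝ) : zeta (2 - Δ) β = β * Real.tan (Real.pi * Δ / 2) := by
  rw [zeta, show Real.pi * (2 - Δ) / 2 = Real.pi - Real.pi * Δ / 2 by ring, Real.tan_pi_sub]
  ring

theorem abs_zeta_two_sub_le {Δ β : ℝ} (hΔ : 0 < Δ) (hΔ' : Δ ≤ 1 / 8) (hβ : |β| ≤ 1) :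
    |zeta (2 - Δ) β| ≤ 2 * Δ := by
  rw [zeta_two_sub]; exact abs_mul_tan_le hΔ hΔ' hβ

theorem gaussianPDFReal_neg (y : ℝ) : ProbabilityTheory.gaussianPDFReal 0 2 (-y)
    = ProbabilityTheory.gaussianPDFReal 0 2 y := by
  rw [gaussianPDFReal_two, gaussianPDFReal_two, neg_sq]

/-- The tail constant of `stdDensity`. -/
def tailConst (Δ : ℝ) : ℝ := Real.pi⁻¹ * Real.sin (Real.pi * Δ / 2) * Real.Gamma (3 - Δ)

/-- The tail constant of `-stdDensityDeriv`. -/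
def tailConstDeriv (Δ : ℝ) : ℝ := Real.pi⁻¹ * Real.sin (Real.pi * Δ / 2) * Real.Gamma (4 - Δ)

theorem exists_two_sided_expansion : ∃ C : ℝ, 0 < C ∧ ∀ Δ β y : ℝ, 0 < Δ → Δ ≤ 1 / 8 → |β| ≤ 1 →
    1 ≤ |y| →
    |stdDensity (zeta (2 - Δ) β) (2 - Δ) y - ProbabilityTheory.gaussianPDFReal 0 2 y
        - (1 + β * Real.sign y) * tailConst Δ * |y| ^ (Δ - 3)| ≤ C * Δ * |y| ^ (Δ - 3) / |y| ∧
    |y * stdDensityDeriv (zeta (2 - Δ) β) (2 - Δ) y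
        + y ^ 2 / 2 * ProbabilityTheory.gaussianPDFReal 0 2 y
        + (1 + β * Real.sign y) * tailConstDeriv Δ * |y| ^ (Δ - 3)|
      ≤ C * Δ * |y| ^ (Δ - 3) / |y| := by
  obtain ⟨C₁, hC₁, h₁⟩ := exists_stdDensity_expansion
  obtain ⟨C₂, hC₂, h₂⟩ := exists_stdDensityDeriv_expansion
  have hpos : ∀ Δ β y : ℝ, 0 < Δ → Δ ≤ 1 / 8 → |β| ≤ 1 → 1 ≤ y →
      |stdDensity (zeta (2 - Δ) β) (2 - Δ) y - ProbabilityTheory.gaussianPDFReal 0 2 y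
        - (1 + β) * tailConst Δ * y ^ (Δ - 3)| ≤ max C₁ C₂ * Δ * y ^ (Δ - 3) / y ∧
      |y * stdDensityDeriv (zeta (2 - Δ) β) (2 - Δ) y
        + y ^ 2 / 2 * ProbabilityTheory.gaussianPDFReal 0 2 y
        + (1 + β) * tailConstDeriv Δ * y ^ (Δ - 3)| ≤ max C₁ C₂ * Δ * y ^ (Δ - 3) / y := by
    intro Δ β y hΔ hΔ' hβ hy
    have hy0 : 0 < y := by linarith
    have e₁ := h₁ Δ β y hΔ hΔ' hβ hy
    have e₂ := h₂ Δ β y hΔ hΔ' hβ hy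
    rw [← zeta_two_sub, stdDensity_gaussian] at e₁
    rw [← zeta_two_sub, stdDensityDeriv_gaussian] at e₂
    have p₄ : y ^ (Δ - 4) = y ^ (Δ - 3) / y := by
      rw [← Real.rpow_sub_one hy0.ne']; ring_nf
    have p₅ : y ^ (Δ - 5) = y ^ (Δ - 3) / y / y := by
      rw [← p₄, ← Real.rpow_sub_one hy0.ne']; ring_nf
    have hP : 0 < y ^ (Δ - 3) := by positivity
    rw [p₄] at e₁ e₂
    rw [p₅] at e₂
    refine ⟨e₁.trans ?_, ?_⟩
    · rw [mul_div_assoc]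
      gcongr
      exact le_max_left _ _
    · have e₃ := mul_le_mul_of_nonneg_left e₂ hy0.le
      rw [← abs_of_pos hy0, ← abs_mul, abs_of_pos hy0] at e₃
      refine (le_of_eq ?_).trans (e₃.trans ?_)
      · congr 1
        unfold tailConstDeriv
        field_simp
        ring
      · rw [show y * (C₂ * Δ * (y ^ (Δ - 3) / y / y)) = C₂ * Δ * y ^ (Δ - 3) / y by field_simp]
        gcongr
        exact le_max_right _ _
  refine ⟨max C₁ C₂, lt_max_of_lt_left hC₁, fun Δ β y hΔ hΔ' hβ hy => ?_⟩
  rcases lt_trichotomy y 0 with hneg | rfl | hy0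
  · rw [abs_of_neg hneg] at hy ⊢
    rw [Real.sign_of_neg hneg]
    have h := hpos Δ (-β) (-y) hΔ hΔ' (by rwa [abs_neg]) hy
    have hz : zeta (2 - Δ) (-β) = -zeta (2 - Δ) β := by simp [zeta]
    rw [hz, stdDensity_neg, stdDensityDeriv_neg, neg_neg, gaussianPDFReal_neg, neg_mul_neg,
      neg_sq] at h
    rwa [mul_neg_one]
  · norm_num at hy
  · rw [abs_of_pos hy0] at hy ⊢
    rw [Real.sign_of_pos hy0, mul_one]
    exact hpos Δ β y hΔ hΔ' hβ hy

/-- The derivative of `sin(πΔ/2)` at `0` is `π/2`. With `c = 3` and `c = 4` the limits are `Γ(3)/2 =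
1` and `Γ(4)/2 = 3`, the coefficients of `F₂` and of `F₂'`. -/
theorem tendsto_tail {c : ℝ} (hc : 0 < c) :
    Filter.Tendsto (fun Δ : ℝ => Real.pi⁻¹ * Real.sin (Real.pi * Δ / 2) * Real.Gamma (c - Δ) / Δ)
      (nhdsWithin 0 {0}ᶜ) (nhds (Real.Gamma c / 2)) := by
  have hs : HasDerivAt (fun Δ : ℝ => Real.sin (Real.pi * Δ / 2)) (Real.pi / 2) 0 := by
    have h1 : HasDerivAt (fun Δ : ℝ => Real.pi * Δ / 2) (Real.pi / 2) 0 := by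
      simpa using! ((hasDerivAt_id (0 : ℝ)).const_mul Real.pi).div_const 2
    simpa using! h1.sin
  have hslope := hs.tendsto_slope_zero
  have hΓ : Filter.Tendsto (fun Δ : ℝ => Real.Gamma (c - Δ)) (nhdsWithin 0 {0}ᶜ)
      (nhds (Real.Gamma c)) := by
    have h1 : ContinuousAt Real.Gamma (c - 0) :=
      (Real.differentiableAt_Gamma fun m => by
        have : (0 : ℝ) ≤ m := Nat.cast_nonneg m
        linarith).continuousAt
    have h2 : ContinuousAt (fun Δ : ℝ => Real.Gamma (c - Δ)) 0 :=
      ContinuousAt.comp (f := fun Δ : ℝ => c - Δ) h1 (by fun_prop)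
    have h3 := h2.tendsto
    simp only [sub_zero] at h3
    exact h3.mono_left nhdsWithin_le_nhds
  have h := (hslope.mul hΓ).const_mul Real.pi⁻¹
  have hpi := Real.pi_pos.ne'
  rw [show Real.pi⁻¹ * (Real.pi / 2 * Real.Gamma c) = Real.Gamma c / 2 by field_simp] at h
  refine h.congr fun Δ => ?_
  simp only [zero_add, mul_zero, zero_div, Real.sin_zero, sub_zero, smul_eq_mul]
  ring

theorem exists_tailConst_close {η : ℝ} (hη : 0 < η) : ∃ Δ₀ : ℝ, 0 < Δ₀ ∧ ∀ Δ : ℝ, 0 < Δ → Δ < Δ₀ →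
    |tailConst Δ - Δ| ≤ η * Δ ∧ |tailConstDeriv Δ - 3 * Δ| ≤ η * Δ := by
  have h₁ := tendsto_tail (c := 3) (by norm_num)
  have h₂ := tendsto_tail (c := 4) (by norm_num)
  have g₃ : Real.Gamma 3 / 2 = 1 := by
    rw [Real.Gamma_ofNat_eq_factorial 2]; norm_num [Nat.factorial]
  have g₄ : Real.Gamma 4 / 2 = 3 := by
    rw [Real.Gamma_ofNat_eq_factorial 3]; norm_num [Nat.factorial]
  rw [g₃] at h₁
  rw [g₄] at h₂
  obtain ⟨d₁, hd₁, k₁⟩ := Metric.tendsto_nhdsWithin_nhds.1 h₁ η hη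
  obtain ⟨d₂, hd₂, k₂⟩ := Metric.tendsto_nhdsWithin_nhds.1 h₂ η hη
  refine ⟨min d₁ d₂, lt_min hd₁ hd₂, fun Δ hΔ hΔ' => ?_⟩
  have hdist : dist Δ 0 = Δ := by rw [Real.dist_eq, sub_zero, abs_of_pos hΔ]
  have m₁ := k₁ (x := Δ) hΔ.ne' (by rw [hdist]; exact hΔ'.trans_le (min_le_left _ _))
  have m₂ := k₂ (x := Δ) hΔ.ne' (by rw [hdist]; exact hΔ'.trans_le (min_le_right _ _))
  rw [Real.dist_eq] at m₁ m₂
  constructor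
  · rw [show tailConst Δ - Δ = (tailConst Δ / Δ - 1) * Δ by field_simp, abs_mul, abs_of_pos hΔ]
    exact mul_le_mul_of_nonneg_right m₁.le hΔ.le
  · rw [show tailConstDeriv Δ - 3 * Δ = (tailConstDeriv Δ / Δ - 3) * Δ by field_simp, abs_mul,
      abs_of_pos hΔ]
    exact mul_le_mul_of_nonneg_right m₂.le hΔ.le

/-! ### The scale derivative of the density against its approximation. -/

theorem F₂_eq (Δ β x : ℝ) : F₂ (2 - Δ) β x
    = (1 + betaStar (2 - Δ) β x) * Δ * |x - zeta (2 - Δ) β| ^ (Δ - 3) := by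
  unfold F₂; rw [sub_sub_cancel]

/-- The coefficient `2` is `3 - 1`: the exponent `3` used in `F₂'`, minus the copy of `F₂` in `g`.
Keeping `3` instead of `3 - Δ` makes it exact. -/
theorem gScale_eq {Δ β x : ℝ} (hy : x - zeta (2 - Δ) β ≠ 0) :
    gScale (2 - Δ) β x = ((x - zeta (2 - Δ) β) ^ 2 / 2 - 1) * F₁ (2 - Δ) β x
      + 2 * F₂ (2 - Δ) β x := by
  have hs : (x - zeta (2 - Δ) β) * Real.sign (x - zeta (2 - Δ) β) = |x - zeta (2 - Δ) β| := by
    rcases lt_or_gt_of_ne hy with h | h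
    · rw [Real.sign_of_neg h, abs_of_neg h]; ring
    · rw [Real.sign_of_pos h, abs_of_pos h]; ring
  have hp : |x - zeta (2 - Δ) β| * |x - zeta (2 - Δ) β| ^ (Δ - 4)
      = |x - zeta (2 - Δ) β| ^ (Δ - 3) := by
    rw [mul_comm, ← Real.rpow_add_one (abs_pos.2 hy).ne']; ring_nf
  simp only [gScale, g, g', F₁', F₂', F₂_eq, F₁, sub_sub_cancel]
  linear_combination (3 * (1 + betaStar (2 - Δ) β x) * Δ) * hp
    + (3 * (1 + betaStar (2 - Δ) β x) * Δ * |x - zeta (2 - Δ) β| ^ (Δ - 4)) * hs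

theorem F₁_pos (α β x : ℝ) : 0 < F₁ α β x :=
  ProbabilityTheory.gaussianPDFReal_pos _ _ _ (by norm_num)

theorem abs_betaStar_le (α β x : ℝ) : |betaStar α β x| ≤ |β| := by
  unfold betaStar
  rw [abs_mul]
  refine mul_le_of_le_one_right (abs_nonneg _) ?_
  rcases Real.sign_apply_eq (x - zeta α β) with h | h | h <;> rw [h] <;> norm_num

theorem one_sub_le_one_add_betaStar (α β x : ℝ) : 1 - |β| ≤ 1 + betaStar α β x := by
  linarith [neg_le_of_abs_le (abs_betaStar_le α β x)]

theorem one_add_betaStar_le_two {β : ℝ} (hβ : |β| < 1) (α x : ℝ) : 1 + betaStar α β x ≤ 2 := by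
  linarith [le_of_abs_le (abs_betaStar_le α β x)]

theorem F₂_pos {Δ β x : ℝ} (hβ : |β| < 1) (hΔ : 0 < Δ) (hy : x - zeta (2 - Δ) β ≠ 0) :
    0 < F₂ (2 - Δ) β x := by
  rw [F₂_eq]
  have h1 := one_sub_le_one_add_betaStar (2 - Δ) β x
  have h2 : 0 < 1 + betaStar (2 - Δ) β x := by linarith
  have h3 := abs_pos.2 hy
  positivity

theorem abs_tail_error_le {B a d Δ P : ℝ} (hB : 0 < B) (hB₂ : B ≤ 2) (hP : 0 < P) {q : ℝ}
    (T : |a - d| ≤ q * Δ) : |B * (a - d) * P| ≤ 2 * q * (Δ * P) := by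
  rw [abs_mul, abs_mul, abs_of_pos hP, abs_of_pos hB]
  calc B * |a - d| * P ≤ 2 * (q * Δ) * P := by gcongr
    _ = _ := by ring

theorem abs_mul_deriv_le {B b Δ P φ y h' C t : ℝ} (hB : 0 < B) (hB₂ : B ≤ 2) (hΔ : 0 < Δ)
    (hP : 0 < P) (hφ : 0 < φ) (T₂ : |b - 3 * Δ| ≤ Δ)
    (E₂ : |y * h' + y ^ 2 / 2 * φ + B * b * P| ≤ t) (herr' : t ≤ C * (Δ * P)) :
    |y * h'| ≤ y ^ 2 / 2 * φ + 8 * (Δ * P) + C * (Δ * P) := by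
  have hb : |b| ≤ 4 * Δ := by
    have : |b| ≤ |b - 3 * Δ| + |3 * Δ| := by
      simpa using abs_add_le (b - 3 * Δ) (3 * Δ)
    rw [abs_of_pos (show 0 < 3 * Δ by positivity)] at this
    linarith
  have hBb : |B * b * P| ≤ 8 * (Δ * P) := by
    rw [abs_mul, abs_mul, abs_of_pos hP, abs_of_pos (show 0 < B by linarith)]
    calc B * |b| * P ≤ 2 * (4 * Δ) * P := by gcongr
      _ = _ := by ring
  have hsq : 0 ≤ y ^ 2 / 2 * φ := by positivity
  rw [abs_le] at E₂ hBb ⊢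
  constructor <;> linarith [E₂.1, E₂.2, hBb.1, hBb.2]

/-- Since `|y| ≥ 1`, `|ζ h'| ≤ 2Δ|y h'|`, and `y h'` is comparable with the two parts of `g_σ`; the
extra `Δ` makes the product small relative to them. -/
theorem abs_shift_mul_deriv_le {Δ P φ y h' C ζ e κ : ℝ} (hΔ : 0 < Δ) (hP : 0 < P) (hφ : 0 < φ)
    (hζ : |ζ| ≤ 2 * Δ) (hY2 : 2 ≤ |y|) (hlt₃ : Δ ≤ e / 4) (hlt₄ : Δ * (4 * (8 + C)) ≤ κ * e)
    (hyh' : |y * h'| ≤ y ^ 2 / 2 * φ + 8 * (Δ * P) + C * (Δ * P)) :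
    |ζ * h'| ≤ e / 4 * y ^ 2 * φ + κ * e / 2 * (Δ * P) := by
  have h1 : |ζ * h'| ≤ 2 * Δ * |y * h'| := by
    rw [abs_mul, abs_mul, ← mul_assoc]
    have : 0 ≤ |h'| := abs_nonneg _
    have h3 : |ζ| ≤ 2 * Δ * |y| := by nlinarith
    exact mul_le_mul_of_nonneg_right h3 this
  have h2 : Δ * y ^ 2 * φ ≤ e / 4 * y ^ 2 * φ := by gcongr
  have h3 : Δ * (4 * (8 + C)) * (Δ * P) ≤ κ * e * (Δ * P) := by gcongr
  calc _ ≤ _ := h1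
    _ ≤ 2 * Δ * (y ^ 2 / 2 * φ + 8 * (Δ * P) + C * (Δ * P)) := by gcongr
    _ = Δ * y ^ 2 * φ + Δ * (4 * (8 + C)) * (Δ * P) / 2 := by ring
    _ ≤ _ := by linarith

theorem abs_scale_sub_le {B a b Δ P φ x y h h' ζ e κ t : ℝ} (hx' : x = y + ζ) (he0 : 0 < e)
    (E₁ : |h - φ - B * a * P| ≤ t)
    (E₂ : |y * h' + y ^ 2 / 2 * φ + B * b * P| ≤ t) (herr : t ≤ κ * e / 4 * (Δ * P))
    (t₁ : |B * (a - Δ) * P| ≤ 2 * (κ * e / 8) * (Δ * P))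
    (t₂ : |B * (b - 3 * Δ) * P| ≤ 2 * (κ * e / 8) * (Δ * P))
    (hζh' : |ζ * h'| ≤ e / 4 * y ^ 2 * φ + κ * e / 2 * (Δ * P))
    (hGlow : y ^ 2 / 4 * φ + 2 * κ * (Δ * P) ≤ (y ^ 2 / 2 - 1) * φ + 2 * (B * Δ * P)) :
    |-h - x * h' - ((y ^ 2 / 2 - 1) * φ + 2 * (B * Δ * P))|
      ≤ e * ((y ^ 2 / 2 - 1) * φ + 2 * (B * Δ * P)) := by
  have hsplit : -h - x * h' - ((y ^ 2 / 2 - 1) * φ + 2 * (B * Δ * P)) = -(h - φ - B * a * P)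
      - (y * h' + y ^ 2 / 2 * φ + B * b * P)
      - B * (a - Δ) * P + B * (b - 3 * Δ) * P - ζ * h' := by
    rw [hx']; ring
  -- Error budget: four errors of `κe/4` and one of `κe/2`, all times `ΔP`, stay below `2κe ΔP`; the
  -- Gaussian error `(e/4) y²φ` uses exactly the other term.
  have h1 := mul_le_mul_of_nonneg_left hGlow he0.le
  rw [hsplit]
  rw [abs_le] at E₁ E₂ t₁ t₂ hζh' ⊢
  constructor <;> linarith [E₁.1, E₁.2, E₂.1, E₂.2, t₁.1, t₁.2, t₂.1, t₂.2, hζh'.1, hζh'.2]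

theorem densityScale_ratio (β : ℝ) (hβ : |β| < 1) (ε : ℝ) (hε : 0 < ε) :
    ∃ Δ₀ x₀ : ℝ, 0 < Δ₀ ∧ 0 < x₀ ∧ ∀ Δ x : ℝ, 0 < Δ → Δ < Δ₀ → x₀ < |x| →
      |densityScale (2 - Δ) β x / gScale (2 - Δ) β x - 1| < ε := by
  obtain ⟨C, hC, hexp⟩ := exists_two_sided_expansion
  set κ : ℝ := 1 - |β| with hκ
  have hκ0 : 0 < κ := by linarith
  set e : ℝ := ε / 2 with he
  have he0 : 0 < e := by positivity
  set η : ℝ := min 1 (κ * e / 8) with hη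
  have hη0 : 0 < η := lt_min one_pos (by positivity)
  obtain ⟨Δ₁, hΔ₁, htail⟩ := exists_tailConst_close hη0
  -- The bounds `e/4` and `κe/(4(8+C))` control `ζ h'`; `4C/(κe)` makes the relative tail error
  -- `C/|y|` small. The final `+ 1` covers the shift, as `|ζ| ≤ 1/4`.
  refine ⟨min (min Δ₁ (1 / 8)) (min (e / 4) (κ * e / (4 * (8 + C)))), max 2 (4 * C / (κ * e)) + 1,
    lt_min (lt_min hΔ₁ (by norm_num)) (lt_min (by positivity) (by positivity)),
    by positivity, fun Δ x hΔ hΔ' hx => ?_⟩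
  have hlt₁ : Δ < Δ₁ := hΔ'.trans_le ((min_le_left _ _).trans (min_le_left _ _))
  have hlt₂ : Δ ≤ 1 / 8 := (hΔ'.trans_le ((min_le_left _ _).trans (min_le_right _ _))).le
  have hlt₃ : Δ ≤ e / 4 := (hΔ'.trans_le ((min_le_right _ _).trans (min_le_left _ _))).le
  have hlt₄ : Δ ≤ κ * e / (4 * (8 + C)) :=
    (hΔ'.trans_le ((min_le_right _ _).trans (min_le_right _ _))).le
  rw [le_div_iff₀ (by positivity)] at hlt₄
  have hζ := abs_zeta_two_sub_le hΔ hlt₂ hβ.le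
  set ζ := zeta (2 - Δ) β with hζdef
  set y := x - ζ with hydef
  have hY : max 2 (4 * C / (κ * e)) ≤ |y| := by
    have := abs_sub_abs_le_abs_sub x ζ
    linarith
  have hY2 : 2 ≤ |y| := (le_max_left _ _).trans hY
  have hYC : 4 * C / (κ * e) ≤ |y| := (le_max_right _ _).trans hY
  have hY0 : 0 < |y| := by linarith
  have hy0 : y ≠ 0 := abs_pos.1 hY0
  obtain ⟨E₁, E₂⟩ := hexp Δ β y hΔ hlt₂ hβ.le (by linarith)
  obtain ⟨T₁, T₂⟩ := htail Δ hΔ hlt₁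
  rw [densityScale_eq (by linarith) β x, gScale_eq hy0, F₂_eq]
  have hB₁ := one_sub_le_one_add_betaStar (2 - Δ) β x
  have hB₂ := one_add_betaStar_le_two hβ (2 - Δ) x
  have hφ : 0 < F₁ (2 - Δ) β x := F₁_pos _ _ _
  have hF₁ : ProbabilityTheory.gaussianPDFReal 0 2 y = F₁ (2 - Δ) β x := rfl
  have hBs : 1 + β * Real.sign y = 1 + betaStar (2 - Δ) β x := rfl
  rw [← hζdef] at *
  rw [hF₁, hBs] at E₁ E₂
  rw [← hydef]
  set h := stdDensity ζ (2 - Δ) y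
  set h' := stdDensityDeriv ζ (2 - Δ) y
  set φ := F₁ (2 - Δ) β x
  set B := 1 + betaStar (2 - Δ) β x
  set P := |y| ^ (Δ - 3)
  have hP : 0 < P := by positivity
  have hysq : 4 ≤ y ^ 2 := by rw [← sq_abs]; nlinarith
  have hΔP : 0 < Δ * P := by positivity
  have herr : C * Δ * P / |y| ≤ κ * e / 4 * (Δ * P) := by
    rw [div_le_iff₀ (by positivity)] at hYC
    rw [div_le_iff₀ hY0]
    nlinarith
  have herr' : C * Δ * P / |y| ≤ C * (Δ * P) := by
    rw [div_le_iff₀ hY0]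
    have : 0 < C * (Δ * P) := by positivity
    nlinarith
  have hη1 : η ≤ 1 := min_le_left _ _
  have hη2 : η ≤ κ * e / 8 := min_le_right _ _
  have hB0 : 0 < B := by linarith
  have t₁ := abs_tail_error_le hB0 hB₂ hP (T₁.trans (mul_le_mul_of_nonneg_right hη2 hΔ.le))
  have t₂ := abs_tail_error_le hB0 hB₂ hP (T₂.trans (mul_le_mul_of_nonneg_right hη2 hΔ.le))
  have hyh' := abs_mul_deriv_le hB0 hB₂ hΔ hP hφ (T₂.trans (mul_le_of_le_one_left hΔ.le hη1)) E₂
    herr'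
  have hζh' := abs_shift_mul_deriv_le hΔ hP hφ hζ hY2 hlt₃ hlt₄ hyh'
  set G := (y ^ 2 / 2 - 1) * φ + 2 * (B * Δ * P) with hG
  have hGlow : y ^ 2 / 4 * φ + 2 * κ * (Δ * P) ≤ G := by
    have h1 : y ^ 2 / 4 * φ ≤ (y ^ 2 / 2 - 1) * φ := by gcongr; linarith
    have h2 : κ * (Δ * P) ≤ B * (Δ * P) := by gcongr
    rw [hG]
    linarith
  have hGpos : 0 < G := by
    have : 0 < y ^ 2 / 4 * φ + 2 * κ * (Δ * P) := by positivity
    linarith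
  have hdiff : |-h - x * h' - G| ≤ e * G :=
    abs_scale_sub_le (by rw [hydef]; ring) he0 E₁ E₂ herr t₁ t₂ hζh' hGlow
  rw [div_sub_one hGpos.ne', abs_div, abs_of_pos hGpos, div_lt_iff₀ hGpos]
  have : e * G < ε * G := by gcongr; linarith
  linarith

/-! ### The Gaussian, tail and transition zones. -/

theorem exists_le_sqrt_log (M : ℝ) : ∃ Δ₀ : ℝ, 0 < Δ₀ ∧ ∀ Δ : ℝ, 0 < Δ → Δ < Δ₀ →
    M ≤ √(Real.log (1 / Δ)) := by
  refine ⟨Real.exp (-M ^ 2), Real.exp_pos _, fun Δ hΔ h => Real.le_sqrt_of_sq_le ?_⟩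
  rw [one_div, Real.log_inv]
  have := (Real.log_lt_log hΔ h).le
  rw [Real.log_exp] at this
  linarith

theorem exists_rpow_lt {γ c : ℝ} (hγ : 0 < γ) (hc : 0 < c) : ∃ Δ₀ : ℝ, 0 < Δ₀ ∧ ∀ Δ : ℝ, 0 < Δ →
    Δ < Δ₀ → Δ ^ γ < c := by
  refine ⟨c ^ (1 / γ), by positivity, fun Δ hΔ h => ?_⟩
  have := Real.rpow_lt_rpow hΔ.le h hγ
  rwa [← Real.rpow_mul hc.le, one_div_mul_cancel hγ.ne', Real.rpow_one] at this

theorem exp_mul_log_one_div {Δ : ℝ} (hΔ : 0 < Δ) (a : ℝ) :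
    Real.exp (a * Real.log (1 / Δ)) = Δ ^ (-a) := by
  rw [Real.rpow_def_of_pos hΔ, one_div, Real.log_inv]
  ring_nf

theorem F₁_eq (α β x : ℝ) : F₁ α β x
    = (2 * √Real.pi)⁻¹ * Real.exp (-|x - zeta α β| ^ 2 / 4) := by
  rw [F₁, gaussianPDFReal_two, sq_abs]

/-- For a weighted average of `F - 1` and `2`, the distance to `F - 1` is the weight of `2` times
`|3 - F|`, and that weight is at most `F₂/F₁`. The tail version exchanges the roles. -/
theorem ratio_sub_gaussian {Δ β x : ℝ} (hβ : |β| < 1) (hΔ : 0 < Δ) (hy : x - zeta (2 - Δ) β ≠ 0) :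
    |gScale (2 - Δ) β x / g (2 - Δ) β x - (FScale₁ (2 - Δ) β x - 1)|
      ≤ F₂ (2 - Δ) β x / F₁ (2 - Δ) β x * (3 + FScale₁ (2 - Δ) β x) := by
  have h1 := F₁_pos (2 - Δ) β x
  have h2 := F₂_pos hβ hΔ hy
  rw [gScale_eq hy, g]
  have hF : (x - zeta (2 - Δ) β) ^ 2 / 2 = FScale₁ (2 - Δ) β x := rfl
  have hF0 : 0 ≤ FScale₁ (2 - Δ) β x := by unfold FScale₁; positivity
  rw [hF]
  set F := FScale₁ (2 - Δ) β x
  set a := F₁ (2 - Δ) β x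
  set b := F₂ (2 - Δ) β x
  rw [show ((F - 1) * a + 2 * b) / (a + b) - (F - 1) = b / (a + b) * (3 - F) by field_simp; ring,
    abs_mul, abs_of_pos (by positivity)]
  have h3 : |3 - F| ≤ 3 + F := by rw [abs_le]; constructor <;> linarith
  gcongr
  linarith

theorem ratio_sub_tail {Δ β x : ℝ} (hβ : |β| < 1) (hΔ : 0 < Δ) (hy : x - zeta (2 - Δ) β ≠ 0) :
    |gScale (2 - Δ) β x / g (2 - Δ) β x - FScale₂|
      ≤ F₁ (2 - Δ) β x / F₂ (2 - Δ) β x * (3 + FScale₁ (2 - Δ) β x) := by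
  have h1 := F₁_pos (2 - Δ) β x
  have h2 := F₂_pos hβ hΔ hy
  rw [gScale_eq hy, g, FScale₂]
  have hF : (x - zeta (2 - Δ) β) ^ 2 / 2 = FScale₁ (2 - Δ) β x := rfl
  have hF0 : 0 ≤ FScale₁ (2 - Δ) β x := by unfold FScale₁; positivity
  rw [hF]
  set F := FScale₁ (2 - Δ) β x
  set a := F₁ (2 - Δ) β x
  set b := F₂ (2 - Δ) β x
  rw [show ((F - 1) * a + 2 * b) / (a + b) - 2 = a / (a + b) * (F - 3) by field_simp; ring,
    abs_mul, abs_of_pos (by positivity)]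
  have h3 : |F - 3| ≤ 3 + F := by rw [abs_le]; constructor <;> linarith
  gcongr
  linarith

theorem abs_ratio_le {Δ β x : ℝ} (hβ : |β| < 1) (hΔ : 0 < Δ) (hy : x - zeta (2 - Δ) β ≠ 0) :
    |gScale (2 - Δ) β x / g (2 - Δ) β x| ≤ (x - zeta (2 - Δ) β) ^ 2 / 2 + 2 := by
  have h1 := F₁_pos (2 - Δ) β x
  have h2 := F₂_pos hβ hΔ hy
  rw [gScale_eq hy, g]
  have hF0 : 0 ≤ (x - zeta (2 - Δ) β) ^ 2 / 2 := by positivity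
  set F := (x - zeta (2 - Δ) β) ^ 2 / 2
  set a := F₁ (2 - Δ) β x
  set b := F₂ (2 - Δ) β x
  rw [abs_div, abs_of_pos (show 0 < a + b by positivity), div_le_iff₀ (by positivity), abs_le]
  constructor <;> nlinarith [mul_nonneg hF0 h1.le, mul_nonneg hF0 h2.le]

theorem gaussian_zone (β : ℝ) (hβ : |β| < 1) {δ : ℝ} (hδ : 0 < δ) (hδ2 : δ < 2) {x₀ : ℝ}
    (hx₀ : 0 < x₀) {η : ℝ} (hη : 0 < η) : ∃ Δ₀ : ℝ, 0 < Δ₀ ∧ ∀ Δ x : ℝ, 0 < Δ → Δ < Δ₀ → x₀ < |x| →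
      |x - zeta (2 - Δ) β| ≤ (2 - δ) * √(Real.log (1 / Δ)) →
      |gScale (2 - Δ) β x / g (2 - Δ) β x - (FScale₁ (2 - Δ) β x - 1)|
        ≤ η * Δ ^ (δ / 2) * FScale₁ (2 - Δ) β x := by
  -- A lower bound for `|y|`, valid once `|ζ| ≤ x₀/2`. Being at most `1`, it lets `|y|^(Δ-3)` be
  -- bounded by `ρ^(-3)` uniformly in `Δ`.
  set ρ : ℝ := min (x₀ / 2) 1 with hρ
  have hρ0 : 0 < ρ := lt_min (by positivity) one_pos
  have hsp : 0 < √Real.pi := Real.sqrt_pos.2 Real.pi_pos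
  set K : ℝ := 2 * ρ ^ (-3 : ℝ) * (2 * √Real.pi) * (1 + 6 / ρ ^ 2) with hK
  have hK0 : 0 < K := by positivity
  -- In this zone `Δ exp(y²/4) ≤ Δ^(1 - (1-δ/2)²)`, and the exponent equals `δ/2 + (δ/2)(1 - δ/2)`.
  -- The second summand is the surplus that yields `o(Δ^(δ/2))`.
  have hγ : 0 < δ / 2 * (1 - δ / 2) := by
    have : 0 < 1 - δ / 2 := by linarith
    positivity
  obtain ⟨Δ₁, hΔ₁, hpow⟩ := exists_rpow_lt hγ (div_pos hη hK0)
  refine ⟨min Δ₁ (min (1 / 8) (x₀ / 4)), lt_min hΔ₁ (lt_min (by norm_num) (by positivity)),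
    fun Δ x hΔ hΔ' hx hzone => ?_⟩
  have hlt₁ : Δ < Δ₁ := hΔ'.trans_le (min_le_left _ _)
  have hlt₂ : Δ ≤ 1 / 8 := (hΔ'.trans_le ((min_le_right _ _).trans (min_le_left _ _))).le
  have hlt₃ : Δ ≤ x₀ / 4 := (hΔ'.trans_le ((min_le_right _ _).trans (min_le_right _ _))).le
  have hζ := abs_zeta_two_sub_le hΔ hlt₂ hβ.le
  have hY : ρ ≤ |x - zeta (2 - Δ) β| := by
    have := abs_sub_abs_le_abs_sub x (zeta (2 - Δ) β)
    exact (min_le_left _ _).trans (by linarith)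
  have hY0 : 0 < |x - zeta (2 - Δ) β| := hρ0.trans_le hY
  have hy0 : x - zeta (2 - Δ) β ≠ 0 := abs_pos.1 hY0
  refine (ratio_sub_gaussian hβ hΔ hy0).trans ?_
  have hB₂ := one_add_betaStar_le_two hβ (2 - Δ) x
  have hFabs : FScale₁ (2 - Δ) β x = |x - zeta (2 - Δ) β| ^ 2 / 2 := by rw [FScale₁, sq_abs]
  rw [hFabs, F₁_eq, F₂_eq]
  set Y := |x - zeta (2 - Δ) β|
  set B := 1 + betaStar (2 - Δ) β x
  have hlog : 0 ≤ Real.log (1 / Δ) := by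
    refine Real.log_nonneg ?_
    rw [le_div_iff₀ hΔ]; linarith
  have hpowY : Y ^ (Δ - 3) ≤ ρ ^ (-3 : ℝ) :=
    (Real.rpow_le_rpow_of_nonpos hρ0 hY (by linarith)).trans
      (Real.rpow_le_rpow_of_exponent_ge hρ0 (min_le_right _ _) (by linarith))
  have hexp : Real.exp (Y ^ 2 / 4) ≤ Δ ^ (-(1 - δ / 2) ^ 2) := by
    rw [← exp_mul_log_one_div hΔ]
    refine Real.exp_le_exp.2 ?_
    have h1 : Y ^ 2 ≤ ((2 - δ) * √(Real.log (1 / Δ))) ^ 2 := by gcongr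
    rw [mul_pow, Real.sq_sqrt hlog] at h1
    nlinarith
  have hΔe : Δ * Real.exp (Y ^ 2 / 4) ≤ Δ ^ (δ / 2 * (1 - δ / 2)) * Δ ^ (δ / 2) := by
    calc Δ * Real.exp (Y ^ 2 / 4) ≤ Δ * Δ ^ (-(1 - δ / 2) ^ 2) := by gcongr
      _ = Δ ^ (1 : ℝ) * Δ ^ (-(1 - δ / 2) ^ 2) := by rw [Real.rpow_one]
      _ = Δ ^ (δ / 2 * (1 - δ / 2)) * Δ ^ (δ / 2) := by
        rw [← Real.rpow_add hΔ, ← Real.rpow_add hΔ]; ring_nf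
  have hF3 : 3 + Y ^ 2 / 2 ≤ (1 + 6 / ρ ^ 2) * (Y ^ 2 / 2) := by
    have : ρ ^ 2 ≤ Y ^ 2 := by gcongr
    have h2 : 3 ≤ 6 / ρ ^ 2 * (Y ^ 2 / 2) := by
      rw [div_mul_div_comm, le_div_iff₀ (by positivity)]; linarith
    linarith
  have hdiv : B * Δ * Y ^ (Δ - 3) / ((2 * √Real.pi)⁻¹ * Real.exp (-Y ^ 2 / 4))
      = B * Y ^ (Δ - 3) * (2 * √Real.pi) * (Δ * Real.exp (Y ^ 2 / 4)) := by
    rw [neg_div, Real.exp_neg]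
    field_simp
  rw [hdiv]
  have hKΔ : K * Δ ^ (δ / 2 * (1 - δ / 2)) ≤ η := by
    have := hpow Δ hΔ hlt₁
    rw [lt_div_iff₀ hK0] at this
    linarith
  calc B * Y ^ (Δ - 3) * (2 * √Real.pi) * (Δ * Real.exp (Y ^ 2 / 4)) * (3 + Y ^ 2 / 2)
      ≤ 2 * ρ ^ (-3 : ℝ) * (2 * √Real.pi) * (Δ ^ (δ / 2 * (1 - δ / 2)) * Δ ^ (δ / 2))
        * ((1 + 6 / ρ ^ 2) * (Y ^ 2 / 2)) := by gcongr
    _ = K * Δ ^ (δ / 2 * (1 - δ / 2)) * Δ ^ (δ / 2) * (Y ^ 2 / 2) := by rw [hK]; ring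
    _ ≤ η * Δ ^ (δ / 2) * (Y ^ 2 / 2) := by gcongr

theorem exists_pow_mul_exp_lt {κ c : ℝ} (hκ : 0 < κ) (hc : 0 < c) :
    ∃ Y₀ : ℝ, 1 ≤ Y₀ ∧ ∀ Y : ℝ, Y₀ ≤ Y → Y ^ 5 * Real.exp (-κ * Y ^ 2) < c := by
  have h := (tendsto_rpow_mul_exp_neg_mul_atTop_nhds_zero 5 κ hκ).eventually (gt_mem_nhds hc)
  obtain ⟨Y₁, hY₁⟩ := Filter.eventually_atTop.1 h
  refine ⟨max 1 Y₁, le_max_left _ _, fun Y hY => lt_of_le_of_lt ?_ (hY₁ Y ((le_max_right _ _).trans hY))⟩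
  have h1 : 1 ≤ Y := (le_max_left _ _).trans hY
  rw [show (5 : ℝ) = ((5 : ℕ) : ℝ) by norm_num, Real.rpow_natCast]
  have h2 : Y ≤ Y ^ 2 := by nlinarith
  refine mul_le_mul_of_nonneg_left (Real.exp_le_exp.2 ?_) (by positivity)
  linarith [mul_le_mul_of_nonneg_left h2 hκ.le]

theorem tail_zone (β : ℝ) (hβ : |β| < 1) {δ : ℝ} (hδ : 0 < δ) {η : ℝ} (hη : 0 < η) :
    ∃ Δ₀ : ℝ, 0 < Δ₀ ∧ ∀ Δ x : ℝ, 0 < Δ → Δ < Δ₀ →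
      (2 + δ) * √(Real.log (1 / Δ)) ≤ |x - zeta (2 - Δ) β| →
      |gScale (2 - Δ) β x / g (2 - Δ) β x - FScale₂| ≤ η * Δ ^ (δ / 2) * FScale₂ := by
  set κ : ℝ := 1 - |β| with hκ
  have hκ0 : 0 < κ := by linarith
  -- Of the Gaussian exponent `Y²/4`, the share `Y²/(2(2+δ))` already yields `Δ^(1+δ/2)` in the tail
  -- zone. The remainder `μY²` is left to beat `Y^5`: three powers come from dividing by the tail
  -- and two from `3 + F_σ^1`.
  set μ : ℝ := 1 / 4 - 1 / (2 * (2 + δ)) with hμ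
  have hμ0 : 0 < μ := by
    rw [hμ, sub_pos, div_lt_div_iff₀ (by positivity) (by norm_num)]; linarith
  obtain ⟨Y₀, hY₀, hpow⟩ := exists_pow_mul_exp_lt hμ0 (show 0 < η * κ / 2 by positivity)
  obtain ⟨Δ₁, hΔ₁, hsqrt⟩ := exists_le_sqrt_log Y₀
  refine ⟨min Δ₁ (1 / 8), lt_min hΔ₁ (by norm_num), fun Δ x hΔ hΔ' hzone => ?_⟩
  have hL := hsqrt Δ hΔ (hΔ'.trans_le (min_le_left _ _))
  have hlt₂ : Δ ≤ 1 / 8 := (hΔ'.trans_le (min_le_right _ _)).le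
  have hYge : Y₀ ≤ |x - zeta (2 - Δ) β| := by nlinarith
  have hY1 : 1 ≤ |x - zeta (2 - Δ) β| := hY₀.trans hYge
  have hY0 : 0 < |x - zeta (2 - Δ) β| := by linarith
  have hy0 : x - zeta (2 - Δ) β ≠ 0 := abs_pos.1 hY0
  refine (ratio_sub_tail hβ hΔ hy0).trans ?_
  have hB₁ : κ ≤ 1 + betaStar (2 - Δ) β x := one_sub_le_one_add_betaStar (2 - Δ) β x
  have hFabs : FScale₁ (2 - Δ) β x = |x - zeta (2 - Δ) β| ^ 2 / 2 := by rw [FScale₁, sq_abs]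
  rw [hFabs, F₁_eq, F₂_eq, FScale₂]
  have hP5 := hpow _ hYge
  set Y := |x - zeta (2 - Δ) β|
  set B := 1 + betaStar (2 - Δ) β x
  have hB0 : 0 < B := by linarith
  have hlog : 0 ≤ Real.log (1 / Δ) := by
    refine Real.log_nonneg ?_
    rw [le_div_iff₀ hΔ]; linarith
  have hexp : Real.exp (-Y ^ 2 / 4) ≤ Real.exp (-μ * Y ^ 2) * (Δ * Δ ^ (δ / 2)) := by
    have h1 : Δ * Δ ^ (δ / 2) = Real.exp (-(1 + δ / 2) * Real.log (1 / Δ)) := by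
      rw [exp_mul_log_one_div hΔ, neg_neg, Real.rpow_add hΔ, Real.rpow_one]
    rw [h1, ← Real.exp_add]
    refine Real.exp_le_exp.2 ?_
    have h2 : ((2 + δ) * √(Real.log (1 / Δ))) ^ 2 ≤ Y ^ 2 := by gcongr
    rw [mul_pow, Real.sq_sqrt hlog] at h2
    have h3 : (1 + δ / 2) * Real.log (1 / Δ) ≤ Y ^ 2 * (1 / (2 * (2 + δ))) := by
      rw [mul_one_div, le_div_iff₀ (by positivity)]
      linarith
    rw [hμ]
    linarith
  have hsp : 1 ≤ √Real.pi := Real.one_le_sqrt.2 (by linarith [Real.pi_gt_three])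
  have hinv : (2 * √Real.pi)⁻¹ ≤ 1 / 2 := by
    rw [one_div]
    exact inv_anti₀ (by norm_num) (by linarith)
  have hYpow : Y ^ (3 - Δ) ≤ Y ^ 3 := by
    rw [← Real.rpow_natCast]
    exact Real.rpow_le_rpow_of_exponent_le hY1 (by push_cast; linarith)
  have hdiv : (2 * √Real.pi)⁻¹ * Real.exp (-Y ^ 2 / 4) / (B * Δ * Y ^ (Δ - 3))
      = (2 * √Real.pi)⁻¹ * Real.exp (-Y ^ 2 / 4) * Y ^ (3 - Δ) / (B * Δ) := by
    rw [show Δ - 3 = -(3 - Δ) by ring, Real.rpow_neg hY0.le]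
    field_simp
  rw [hdiv]
  have hF : 3 + Y ^ 2 / 2 ≤ 4 * Y ^ 2 := by nlinarith
  calc (2 * √Real.pi)⁻¹ * Real.exp (-Y ^ 2 / 4) * Y ^ (3 - Δ) / (B * Δ) * (3 + Y ^ 2 / 2)
      ≤ 1 / 2 * (Real.exp (-μ * Y ^ 2) * (Δ * Δ ^ (δ / 2))) * Y ^ 3 / (κ * Δ) * (4 * Y ^ 2) := by
        gcongr
    _ = 2 / κ * (Y ^ 5 * Real.exp (-μ * Y ^ 2)) * Δ ^ (δ / 2) := by field_simp; ring
    _ ≤ 2 / κ * (η * κ / 2) * Δ ^ (δ / 2) := by gcongr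
    _ = η * Δ ^ (δ / 2) := by field_simp
    _ ≤ η * Δ ^ (δ / 2) * 2 := by
        have : 0 < η * Δ ^ (δ / 2) := by positivity
        linarith

theorem gaussian_zone_ratio (β : ℝ) (hβ : |β| < 1) {δ : ℝ} (hδ : 0 < δ) (hδ2 : δ < 2) {ε : ℝ}
    (hε : 0 < ε) : ∃ Δ₀ x₀ : ℝ, 0 < Δ₀ ∧ 0 < x₀ ∧ ∀ Δ x : ℝ, 0 < Δ → Δ < Δ₀ → x₀ < |x| →
      |x - zeta (2 - Δ) β| ≤ (2 - δ) * √(Real.log (1 / Δ)) →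
      |gScale (2 - Δ) β x / g (2 - Δ) β x / FScale₁ (2 - Δ) β x - 1| < ε := by
  -- This forces `F_σ^1 ≥ 4/ε`, so the term `-1` costs at most `ε/4` relative to `F_σ^1`; the zone
  -- estimate costs `ε/2`.
  have hx₀ : 0 < 8 / ε + 2 := by positivity
  obtain ⟨Δ₁, hΔ₁, h⟩ := gaussian_zone β hβ hδ hδ2 hx₀ (half_pos hε)
  refine ⟨min Δ₁ (1 / 8), 8 / ε + 2, lt_min hΔ₁ (by norm_num), hx₀, fun Δ x hΔ hΔ' hx hzone => ?_⟩
  have hb := h Δ x hΔ (hΔ'.trans_le (min_le_left _ _)) hx hzone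
  have hlt₂ : Δ ≤ 1 / 8 := (hΔ'.trans_le (min_le_right _ _)).le
  have hζ := abs_zeta_two_sub_le hΔ hlt₂ hβ.le
  have hY : 8 / ε + 1 ≤ |x - zeta (2 - Δ) β| := by
    have := abs_sub_abs_le_abs_sub x (zeta (2 - Δ) β)
    linarith
  have hε8 : 0 < 8 / ε := by positivity
  have hF : 4 / ε ≤ FScale₁ (2 - Δ) β x := by
    have h1 : 8 / ε ≤ (x - zeta (2 - Δ) β) ^ 2 := by rw [← sq_abs]; nlinarith
    rw [FScale₁, show 4 / ε = 8 / ε / 2 by ring]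
    linarith
  have hF0 : 0 < FScale₁ (2 - Δ) β x := lt_of_lt_of_le (by positivity) hF
  have hF4 : 4 ≤ ε * FScale₁ (2 - Δ) β x := by
    rw [div_le_iff₀ hε] at hF; linarith
  set F := FScale₁ (2 - Δ) β x
  set R := gScale (2 - Δ) β x / g (2 - Δ) β x
  have hΔ1 : Δ ^ (δ / 2) ≤ 1 := Real.rpow_le_one hΔ.le (by linarith) (by positivity)
  have hb' : ε / 2 * Δ ^ (δ / 2) * F ≤ ε / 2 * 1 * F := by gcongr
  rw [div_sub_one hF0.ne', abs_div, abs_of_pos hF0, div_lt_iff₀ hF0]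
  have hb2 := hb.trans hb'
  rw [abs_le] at hb2
  rw [abs_lt]
  constructor <;> linarith [hb2.1, hb2.2]

theorem transition_zone (β : ℝ) (hβ : |β| < 1) {δ : ℝ} (hδ2 : δ < 2) :
    ∃ Δ₀ : ℝ, 0 < Δ₀ ∧ ∀ Δ x : ℝ, 0 < Δ → Δ < Δ₀ →
      (|x| ∈ Set.Icc ((2 - δ) * √(Real.log (1 / Δ))) ((2 + δ) * √(Real.log (1 / Δ))) ∨
        |x - zeta (2 - Δ) β| ∈
          Set.Icc ((2 - δ) * √(Real.log (1 / Δ))) ((2 + δ) * √(Real.log (1 / Δ)))) →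
      |gScale (2 - Δ) β x / g (2 - Δ) β x| ≤ 2 * x ^ 2 := by
  have hd : 0 < 2 - δ := by linarith
  -- This makes `|x|` or `|y|` at least `4`, hence `|x| ≥ 3` in either case, where `(|x|+1)²/2 + 2 ≤
  -- 2x²`.
  obtain ⟨Δ₁, hΔ₁, hsqrt⟩ := exists_le_sqrt_log (4 / (2 - δ))
  refine ⟨min Δ₁ (1 / 8), lt_min hΔ₁ (by norm_num), fun Δ x hΔ hΔ' hzone => ?_⟩
  have hL := hsqrt Δ hΔ (hΔ'.trans_le (min_le_left _ _))
  rw [div_le_iff₀ hd] at hL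
  have hζ := abs_zeta_two_sub_le hΔ (hΔ'.trans_le (min_le_right _ _)).le hβ.le
  have hlt₂ : Δ ≤ 1 / 8 := (hΔ'.trans_le (min_le_right _ _)).le
  have hle : |x - zeta (2 - Δ) β| ≤ |x| + |zeta (2 - Δ) β| := abs_sub _ _
  have hge := abs_sub_abs_le_abs_sub x (zeta (2 - Δ) β)
  have hx : 3 ≤ |x| := by
    rcases hzone with h | h <;> linarith [h.1]
  have hy0 : x - zeta (2 - Δ) β ≠ 0 := abs_pos.1 (by linarith)
  refine (abs_ratio_le hβ hΔ hy0).trans ?_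
  rw [← sq_abs, ← sq_abs x]
  have h1 : |x - zeta (2 - Δ) β| ^ 2 ≤ (|x| + 1) ^ 2 := by gcongr; linarith
  nlinarith

end Stable

end

theorem mainTheorem5 (β : ℝ) (hβ : |β| < 1) :
    (∀ ε : ℝ, 0 < ε → ∃ Δ₀ x₀ : ℝ, 0 < Δ₀ ∧ 0 < x₀ ∧
      ∀ Δ x : ℝ, 0 < Δ → Δ < Δ₀ → x₀ < |x| →
        |Stable.densityScale (2 - Δ) β x / Stable.gScale (2 - Δ) β x - 1| < ε) ∧
    (∀ δ : ℝ, 0 < δ → δ < 2 → ∀ x₀ : ℝ, 0 < x₀ → ∀ η : ℝ, 0 < η → ∃ Δ₀ : ℝ, 0 < Δ₀ ∧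
      ∀ Δ x : ℝ, 0 < Δ → Δ < Δ₀ → x₀ < |x| →
        (|x - Stable.zeta (2 - Δ) β| ≤ (2 - δ) * √(Real.log (1 / Δ)) →
          |Stable.gScale (2 - Δ) β x / Stable.g (2 - Δ) β x - (Stable.FScale₁ (2 - Δ) β x - 1)|
            ≤ η * Δ ^ (δ / 2) * Stable.FScale₁ (2 - Δ) β x) ∧
        ((2 + δ) * √(Real.log (1 / Δ)) ≤ |x - Stable.zeta (2 - Δ) β| →
          |Stable.gScale (2 - Δ) β x / Stable.g (2 - Δ) β x - Stable.FScale₂|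
            ≤ η * Δ ^ (δ / 2) * Stable.FScale₂)) ∧
    (∀ δ : ℝ, 0 < δ → δ < 2 → ∀ ε : ℝ, 0 < ε → ∃ Δ₀ x₀ : ℝ, 0 < Δ₀ ∧ 0 < x₀ ∧
      ∀ Δ x : ℝ, 0 < Δ → Δ < Δ₀ → x₀ < |x| →
        |x - Stable.zeta (2 - Δ) β| ≤ (2 - δ) * √(Real.log (1 / Δ)) →
          |Stable.gScale (2 - Δ) β x / Stable.g (2 - Δ) β x / Stable.FScale₁ (2 - Δ) β x - 1|
            < ε) ∧
    (∃ c : ℝ, 0 < c ∧ ∀ δ : ℝ, 0 < δ → δ < 2 → ∃ Δ₀ : ℝ, 0 < Δ₀ ∧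
      ∀ Δ x : ℝ, 0 < Δ → Δ < Δ₀ →
        (|x| ∈ Set.Icc ((2 - δ) * √(Real.log (1 / Δ))) ((2 + δ) * √(Real.log (1 / Δ))) ∨
          |x - Stable.zeta (2 - Δ) β| ∈
            Set.Icc ((2 - δ) * √(Real.log (1 / Δ))) ((2 + δ) * √(Real.log (1 / Δ)))) →
          |Stable.gScale (2 - Δ) β x / Stable.g (2 - Δ) β x| ≤ c * x ^ 2) := by
  refine ⟨Stable.densityScale_ratio β hβ, fun δ hδ hδ2 x₀ hx₀ η hη => ?_,
    fun δ hδ hδ2 ε hε => Stable.gaussian_zone_ratio β hβ hδ hδ2 hε,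
    2, two_pos, fun δ _ hδ2 => Stable.transition_zone β hβ hδ2⟩
  obtain ⟨Δ₁, hΔ₁, h₁⟩ := Stable.gaussian_zone β hβ hδ hδ2 hx₀ hη
  obtain ⟨Δ₂, hΔ₂, h₂⟩ := Stable.tail_zone β hβ hδ hη
  exact ⟨min Δ₁ Δ₂, lt_min hΔ₁ hΔ₂, fun Δ x hΔ hΔ' hx =>
    ⟨h₁ Δ x hΔ (hΔ'.trans_le (min_le_left _ _)) hx, h₂ Δ x hΔ (hΔ'.trans_le (min_le_right _ _))⟩⟩
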